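/- Let $M$ be a connected smooth manifold (Hausdorff, second countable) of dimension $n=p+q\ge 3$ with a conformal structure $c$ of signature $(p,q)$ ($p$ negative and $q$ positive directions), i.e. a class of smooth semi-Riemannian metrics of signature $(p,q)$ on $M$ modulo $g\sim e^{2f}g$, $f\in C^\infty(M)$. Fix any $g\in c$, let $\nabla^g$ be its Levi-Civita connection and $\mathsf P^g=\frac1{n-2}\big(\mathrm{Ric}^g-\frac{\mathrm{scal}^g}{2(n-1)}g\big)$ its Schouten tensor. In the splitting given by $g$, the standard tractor bundle is $\mathcal T=\underline{\mathbb R}\oplus TM\oplus\underline{\mathbb R}\ni(\alpha,Y,\beta)$, with tractor metric $h((\alpha_1,Y_1,\beta_1),(\alpha_2,Y_2,\beta_2))=\alpha_1\beta_2+\alpha_2\beta_1+g(Y_1,Y_2)$ of signature $(p+1,q+1)$, distinguished null line $\mathcal I=\mathbb R\cdot(1,0,0)$, and normal tractor connection $$\nabla_X(\alpha,Y,\beta)=\big(X(\alpha)-\mathsf P^g(X,Y),\ \nabla^g_XY+\alpha X+\beta\,\mathsf P^g(X),\ X(\beta)-g(X,Y)\big).$$ The conformal holonomy group $\mathrm{Hol}_x(M,c)$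 is the group of parallel transports in $\mathcal T$ along piecewise smooth loops at $x$, and $\mathfrak{hol}_x(M,c)\subset\mathfrak{so}(\mathcal T_x,h_x)\cong\mathfrak{so}(p+1,q+1)$ is its Lie algebra. The conformal holonomy is called generic if $\mathfrak{hol}_x(M,c)=\mathfrak{so}(\mathcal T_x,h_x)$ for all $x\in M$. The conformal holonomy distribution is $$\mathcal E_x=\{\,\mathrm{pr}_{T_xM}(\operatorname{Im}A)\mid A\in\mathfrak{hol}_x(M,c),\ A\,\mathcal I=0,\ h(A\,\mathcal I^\perp,\mathcal I^\perp)=0\,\}\subset T_xM,\qquad r^{\mathcal E}(x)=\dim\mathcal E_x .$$ An open set $U\subset M$ is $\mathcal E$-adapted if $r^{\mathcal E}$ is equal to a constant $k$ on $U$ and there are $k$ smooth, pointwise linearly independent vector fields on $U$ with values in $\mathcal E$. (1) Suppose there is a smooth curve $\gamma:(a,b)\to M$, $a<b$, with $g(\dot\gamma,\dot\gamma)\neq0$ everywhere and $r^{\mathcal E}(\gamma(t))=n$ for all $t\in(a,b)$. Then the conformal holonomy is generic. In particular, $r^{\mathcal E}\equiv n$ on $M$. (2) Let $U\subset M$ be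 an $\mathcal E$-adapted open set. Then either $\mathcal E_x$ is a totally lightlike subspace of $T_xM$ for every $x\in U$ (that is, $g(v,w)=0$ for all $v,w\in\mathcal E_x$), or the conformal holonomy is generic. -/

import Mathlib

open Set
open scoped Manifold ContDiff Topology

set_option maxSynthPendingDepth 3

noncomputable section

namespace ConformalHolonomy

/-! ### Semi-Riemannian metrics and conformal structures

`M` is a smooth manifold modelled on the finite-dimensional real vector space `E`. In Mathlib the
tangent space `T_x M` is the model space `E` itself, a vector being identified with its coordinate
expression in the preferred chart at `x`. -/

section Metric

variable (E : Type*) [NormedAddCommGroup E] [NormedSpace ℝ E]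
  (M : Type*) [TopologicalSpace M] [ChartedSpace E M] [IsManifold 𝓘(ℝ, E) ∞ M]

/-- A smooth semi-Riemannian metric of signature `(p, q)` on `M`, with `p` negative and `q` positive
directions: a smooth section of symmetric bilinear forms, each of which has an orthonormal basis
with `p` vectors of square `-1` and `q` vectors of square `1`. -/
structure SemiRiemannianMetric (p q : ℕ) where
  val : ∀ x : M, TangentSpace 𝓘(ℝ, E) x →L[ℝ] TangentSpace 𝓘(ℝ, E) x →L[ℝ] ℝ
  symm : ∀ (x : M) (v w : TangentSpace 𝓘(ℝ, E) x), val x v w = val x w v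
  signature : ∀ x : M, ∃ b : Module.Basis (Fin p ⊕ Fin q) ℝ (TangentSpace 𝓘(ℝ, E) x),
    (∀ i, val x (b i) (b i) = Sum.elim (fun _ => (-1 : ℝ)) (fun _ => 1) i) ∧
    (∀ i j, i ≠ j → val x (b i) (b j) = 0)
  contMDiff : ContMDiff 𝓘(ℝ, E) (𝓘(ℝ, E).prod 𝓘(ℝ, E →L[ℝ] E →L[ℝ] ℝ)) ∞
    (fun x : M => Bundle.TotalSpace.mk' (E →L[ℝ] E →L[ℝ] ℝ)
      (E := fun x : M => TangentSpace 𝓘(ℝ, E) x →L[ℝ] TangentSpace 𝓘(ℝ, E) x →L[ℝ] ℝ) x (val x))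

/-- Conformal equivalence: `ĝ = e^{2f} g` for a smooth function `f` on `M`. -/
def conformalSetoid (p q : ℕ) : Setoid (SemiRiemannianMetric E M p q) where
  r g g' := ∃ f : M → ℝ, ContMDiff 𝓘(ℝ, E) 𝓘(ℝ, ℝ) ∞ f ∧
    ∀ x v w, g'.val x v w = Real.exp (2 * f x) * g.val x v w
  iseqv :=
    { refl := fun g => ⟨fun _ => 0, contMDiff_const, by simp⟩
      symm := by
        rintro g g' ⟨f, hf, h⟩
        refine ⟨fun x => - f x, ?_, fun x v w => ?_⟩
        · exact (contDiff_neg (n := ∞)).contMDiff.comp hf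
        · rw [h, ← mul_assoc, ← Real.exp_add]
          simp
      trans := by
        rintro g g' g'' ⟨f, hf, h⟩ ⟨f', hf', h'⟩
        refine ⟨fun x => f x + f' x, hf.add hf', fun x v w => ?_⟩
        rw [h', h, ← mul_assoc, ← Real.exp_add]
        ring_nf }

/-- A conformal structure of signature `(p, q)` on `M`: a conformal class of metrics. -/
def ConformalStructure (p q : ℕ) : Type _ := Quotient (conformalSetoid E M p q)

variable {E M}

instance (p q : ℕ) : Membership (SemiRiemannianMetric E M p q) (ConformalStructure E M p q) where
  mem c g := Quotient.mk (conformalSetoid E M p q) g = c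

end Metric

/-! ### Levi-Civita connection and curvature of a metric -/

section LeviCivita

variable {E : Type*} [NormedAddCommGroup E] [NormedSpace ℝ E]
  {M : Type*} [TopologicalSpace M] [ChartedSpace E M] [IsManifold 𝓘(ℝ, E) ∞ M] {p q : ℕ}

/-- `g_x`, read as a bilinear form on `E = T_x M`. -/
def SemiRiemannianMetric.form (g : SemiRiemannianMetric E M p q) (x : M) : E →L[ℝ] E →L[ℝ] ℝ :=
  g.val x

theorem form_nondegenerate (g : SemiRiemannianMetric E M p q) (x : M) (v : E)
    (h : ∀ w, g.form x v w = 0) : v = 0 := by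
  obtain ⟨b, hb, hb'⟩ := g.signature x
  change Module.Basis (Fin p ⊕ Fin q) ℝ E at b
  have key : ∀ i, b.repr v i = 0 := by
    intro i
    have h1 : g.form x v (b i) = b.repr v i * g.form x (b i) (b i) := by
      conv_lhs => rw [← b.sum_repr v]
      rw [map_sum, sum_apply, Finset.sum_eq_single i]
      · simp
      · intro j _ hj
        have : g.form x (b j) (b i) = 0 := hb' j i hj
        simp [this]
      · simp
    rw [h] at h1
    have h2 : g.form x (b i) (b i) ≠ 0 := by
      have : g.form x (b i) (b i) = Sum.elim (fun _ => (-1 : ℝ)) (fun _ => 1) i := hb i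
      rw [this]
      rcases i with i | i <;> simp
    rcases mul_eq_zero.1 h1.symm with h3 | h3
    · exact h3
    · exact absurd h3 h2
  exact b.repr.map_eq_zero_iff.1 (Finsupp.ext key)

/-- The metric `g` in the preferred chart around `y`, as a function of the coordinates `u`. -/
def chartMetric (g : SemiRiemannianMetric E M p q) (y : M) (u : E) : E →L[ℝ] E →L[ℝ] ℝ :=
  (g.form ((extChartAt 𝓘(ℝ, E) y).symm u)).bilinearComp
    (tangentCoordChange 𝓘(ℝ, E) y ((extChartAt 𝓘(ℝ, E) y).symm u)
      ((extChartAt 𝓘(ℝ, E) y).symm u))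
    (tangentCoordChange 𝓘(ℝ, E) y ((extChartAt 𝓘(ℝ, E) y).symm u)
      ((extChartAt 𝓘(ℝ, E) y).symm u))

/-- The Christoffel symbols of the first kind, for a metric `G` on an open set of `E`:
`K(v, w) z = (1/2) (D_v G(w, z) + D_w G(v, z) - D_z G(v, w))`. -/
def christoffelLower (G : E → E →L[ℝ] E →L[ℝ] ℝ) (u : E) : E →L[ℝ] E →L[ℝ] (E →L[ℝ] ℝ) :=
  (1 / 2 : ℝ) • (fderiv ℝ G u + (fderiv ℝ G u).flip -
    (ContinuousLinearMap.flipₗᵢ ℝ E E ℝ).toContinuousLinearEquiv.toContinuousLinearMap.comp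
      (fderiv ℝ G u).flip)

theorem christoffelLower_apply (G : E → E →L[ℝ] E →L[ℝ] ℝ) (u v w z : E) :
    christoffelLower G u v w z =
      (1 / 2 : ℝ) * (fderiv ℝ G u v w z + fderiv ℝ G u w v z - fderiv ℝ G u z v w) := by
  simp [christoffelLower]

/-- The Christoffel symbols `Γ(v, w)` of the Levi-Civita connection of `G`, characterised by
`G(Γ(v, w), z) = K(v, w) z`. Here `G u : E → E*` is invertible since `G u` is nondegenerate. -/
def christoffel (G : E → E →L[ℝ] E →L[ℝ] ℝ) (u : E) : E →L[ℝ] E →L[ℝ] E :=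
  (ContinuousLinearMap.compL ℝ E (E →L[ℝ] ℝ) E (G u).inverse).comp (christoffelLower G u)

/-- The curvature `R(v, w) z` of the Levi-Civita connection of `G`, as an endomorphism in `v`,
with `R(X, Y) = [∇_X, ∇_Y] - ∇_{[X, Y]}`. -/
def curvature (G : E → E →L[ℝ] E →L[ℝ] ℝ) (u w z : E) : E →ₗ[ℝ] E where
  toFun v := fderiv ℝ (christoffel G) u v w z - fderiv ℝ (christoffel G) u w v z
    + christoffel G u v (christoffel G u w z) - christoffel G u w (christoffel G u v z)
  map_add' v v' := by simp only [map_add, add_apply]; abel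
  map_smul' a v := by simp [smul_sub, smul_add]

/-- The Ricci tensor `Ric(w, z) = tr (v ↦ R(v, w) z)`. -/
def ricci (G : E → E →L[ℝ] E →L[ℝ] ℝ) (u : E) : E →ₗ[ℝ] E →ₗ[ℝ] ℝ :=
  LinearMap.mk₂ ℝ (fun w z => LinearMap.trace ℝ E (curvature G u w z))
    (fun w w' z => by
      rw [← map_add]; congr 1; ext v; simp [curvature]; abel)
    (fun a w z => by
      rw [← map_smul]; congr 1; ext v; simp [curvature, smul_sub, smul_add])
    (fun w z z' => by
      rw [← map_add]; congr 1; ext v; simp [curvature]; abel)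
    (fun a w z => by
      rw [← map_smul]; congr 1; ext v; simp [curvature, smul_sub, smul_add])

variable [FiniteDimensional ℝ E]

/-- For a nondegenerate form `B`, the endomorphism `S^♯` with `B(S^♯ v, ·) = S(v, ·)`. -/
def raise (B : E →L[ℝ] E →L[ℝ] ℝ) (S : E →ₗ[ℝ] E →ₗ[ℝ] ℝ) : E →ₗ[ℝ] E :=
  (B.inverse : (E →L[ℝ] ℝ) →ₗ[ℝ] E) ∘ₗ
    (LinearMap.toContinuousLinearMap : (E →ₗ[ℝ] ℝ) ≃ₗ[ℝ] (E →L[ℝ] ℝ)).toLinearMap ∘ₗ S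

/-- The Ricci tensor of `g` at `x`. -/
def SemiRiemannianMetric.ric (g : SemiRiemannianMetric E M p q) (x : M) : E →ₗ[ℝ] E →ₗ[ℝ] ℝ :=
  ricci (chartMetric g x) (extChartAt 𝓘(ℝ, E) x x)

/-- The scalar curvature `scal = tr_g Ric` of `g` at `x`. -/
def SemiRiemannianMetric.scal (g : SemiRiemannianMetric E M p q) (x : M) : ℝ :=
  LinearMap.trace ℝ E (raise (g.form x) (g.ric x))

/-- The Schouten tensor `P = (Ric - scal / (2 (n - 1)) g) / (n - 2)`, `n = p + q`, as a bilinear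
form on `T_x M`. -/
def SemiRiemannianMetric.schouten (g : SemiRiemannianMetric E M p q) (x : M) :
    E →ₗ[ℝ] E →ₗ[ℝ] ℝ :=
  (1 / ((p : ℝ) + q - 2)) • (g.ric x - (g.scal x / (2 * ((p : ℝ) + q - 1))) •
    (ContinuousLinearMap.coeLM ℝ ∘ₗ (g.form x : E →ₗ[ℝ] E →L[ℝ] ℝ)))

/-- The Schouten tensor as a `g`-symmetric endomorphism of `T_x M`. -/
def SemiRiemannianMetric.schoutenEnd (g : SemiRiemannianMetric E M p q) (x : M) : E →ₗ[ℝ] E :=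
  raise (g.form x) (g.schouten x)

end LeviCivita

/-! ### The standard tractor bundle and its normal connection -/

section Tractor

variable {E : Type*} [NormedAddCommGroup E] [NormedSpace ℝ E] [FiniteDimensional ℝ E]
  {M : Type*} [TopologicalSpace M] [ChartedSpace E M] [IsManifold 𝓘(ℝ, E) ∞ M] {p q : ℕ}

variable (E) in
/-- The fibre `ℝ ⊕ T_x M ⊕ ℝ` of the standard tractor bundle in the splitting given by a metric
in the conformal class; `(α, Y, β)` stands for `α s₋ + Y + β s₊`. -/
abbrev Tractor : Type _ := ℝ × E × ℝ

/-- The tractor metric `h((α₁, Y₁, β₁), (α₂, Y₂, β₂)) = α₁ β₂ + α₂ β₁ + g(Y₁, Y₂)` at `x`. -/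
def tractorMetric (g : SemiRiemannianMetric E M p q) (x : M) (S T : Tractor E) : ℝ :=
  S.1 * T.2.2 + T.1 * S.2.2 + g.form x S.2.1 T.2.1

/-- The velocity `γ̇(t)`, a vector in `T_{γ(t)} M = E`. -/
def velocity (γ : ℝ → M) (t : ℝ) : E :=
  (mfderiv 𝓘(ℝ, ℝ) 𝓘(ℝ, E) γ t : ℝ →L[ℝ] E) 1

/-- The tractor field `t ↦ (α(t), Y(t), β(t))` along the curve `γ`, with `Y(t) ∈ T_{γ(t)} M`, is
differentiable at `t` and parallel there for the normal tractor connection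
`∇_X (α, Y, β) = (X(α) - P(X, Y), ∇_X Y + α X + β P(X), X(β) - g(X, Y))`, `X = γ̇`.
The covariant derivative of `Y` is computed in the preferred chart at `γ(t)`, where it is
the derivative of the coordinate expression of `Y` plus `Γ(γ̇, Y)`. -/
structure IsParallelAt (g : SemiRiemannianMetric E M p q) (γ : ℝ → M) (T : ℝ → Tractor E)
    (t : ℝ) : Prop where
  top : HasDerivAt (fun s => (T s).1) (g.schouten (γ t) (velocity γ t) (T t).2.1) t
  mid : HasDerivAt (fun s => tangentCoordChange 𝓘(ℝ, E) (γ s) (γ t) (γ s) (T s).2.1)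
    (-(christoffel (chartMetric g (γ t)) (extChartAt 𝓘(ℝ, E) (γ t) (γ t))
        (velocity γ t) (T t).2.1)
      - (T t).1 • velocity γ t - (T t).2.2 • g.schoutenEnd (γ t) (velocity γ t)) t
  bot : HasDerivAt (fun s => (T s).2.2) (g.form (γ t) (velocity γ t) (T t).2.1) t

/-- `P` is the parallel transport of tractors from `γ 0` to `γ 1` along the smooth curve `γ`. -/
def IsSmoothTransport (g : SemiRiemannianMetric E M p q) (γ : ℝ → M)
    (P : Tractor E ≃L[ℝ] Tractor E) : Prop :=
  ContMDiff 𝓘(ℝ, ℝ) 𝓘(ℝ, E) ∞ γ ∧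
    ∀ v : Tractor E, ∃ T : ℝ → Tractor E, (∀ t, IsParallelAt g γ T t) ∧ T 0 = v ∧ T 1 = P v

/-- `P` is the parallel transport of tractors along some piecewise smooth curve from `x` to `y`,
that is, along a concatenation of finitely many smooth curves. -/
inductive IsTransport (g : SemiRiemannianMetric E M p q) :
    M → M → (Tractor E ≃L[ℝ] Tractor E) → Prop
  | refl (x : M) : IsTransport g x x (ContinuousLinearEquiv.refl ℝ (Tractor E))
  | snoc {x : M} {P Q : Tractor E ≃L[ℝ] Tractor E} (γ : ℝ → M)
      (hP : IsTransport g x (γ 0) P) (hQ : IsSmoothTransport g γ Q) :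
      IsTransport g x (γ 1) (P.trans Q)

theorem IsTransport.trans {g : SemiRiemannianMetric E M p q} {x y z : M}
    {P Q : Tractor E ≃L[ℝ] Tractor E} (hP : IsTransport g x y P) (hQ : IsTransport g y z Q) :
    IsTransport g x z (P.trans Q) := by
  induction hQ with
  | refl => exact hP
  | snoc γ _ hQ ih =>
    have h := IsTransport.snoc γ ih hQ
    exact h

theorem IsSmoothTransport.symm {g : SemiRiemannianMetric E M p q} {γ : ℝ → M}
    {P : Tractor E ≃L[ℝ] Tractor E} (h : IsSmoothTransport g γ P) :
    IsSmoothTransport g (fun t => γ (1 - t)) P.symm := by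
  obtain ⟨hγ, h⟩ := h
  have hsub : ContMDiff 𝓘(ℝ, ℝ) 𝓘(ℝ, ℝ) ∞ (fun t : ℝ => 1 - t) :=
    (contDiff_const.sub contDiff_id).contMDiff
  have hd : ∀ t : ℝ, HasDerivAt (fun t : ℝ => 1 - t) (-1) t := fun t => by
    simpa using (hasDerivAt_id t).const_sub 1
  have hvel : ∀ t, velocity (E := E) (fun t => γ (1 - t)) t = - velocity γ (1 - t) := by
    intro t
    have h1 : HasMFDerivAt 𝓘(ℝ, ℝ) 𝓘(ℝ, E) γ (1 - t) (mfderiv 𝓘(ℝ, ℝ) 𝓘(ℝ, E) γ (1 - t)) :=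
      ((hγ (1 - t)).mdifferentiableAt (by simp)).hasMFDerivAt
    have h2 : HasMFDerivAt 𝓘(ℝ, ℝ) 𝓘(ℝ, ℝ) (fun t : ℝ => 1 - t) t _ :=
      (hd t).hasFDerivAt.hasMFDerivAt
    have h3 := (HasMFDerivAt.comp t h1 h2).mfderiv
    unfold velocity
    have h4 : (fun t => γ (1 - t)) = γ ∘ (fun t : ℝ => 1 - t) := rfl
    rw [h4, h3]
    have h5 : ∀ L : ℝ →L[ℝ] E,
        (L.comp (ContinuousLinearMap.toSpanSingleton ℝ (-1 : ℝ))) 1 = - L 1 := fun L => by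
      simp [← map_neg]
    exact h5 _
  refine ⟨hγ.comp hsub, fun v => ?_⟩
  obtain ⟨T, hT, h0, h1⟩ := h (P.symm v)
  refine ⟨fun t => T (1 - t), fun t => ⟨?_, ?_, ?_⟩, by simp [h1], by simp [h0]⟩
  · refine ((hT (1 - t)).top.scomp t (hd t)).congr_deriv ?_
    rw [hvel]
    simp
  · refine ((hT (1 - t)).mid.scomp t (hd t)).congr_deriv ?_
    rw [hvel]
    simp only [map_neg, neg_apply, smul_neg, neg_smul, one_smul]
    abel
  · refine ((hT (1 - t)).bot.scomp t (hd t)).congr_deriv ?_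
    rw [hvel]
    simp

theorem IsTransport.symm {g : SemiRiemannianMetric E M p q} {x y : M}
    {P : Tractor E ≃L[ℝ] Tractor E} (h : IsTransport g x y P) : IsTransport g y x P.symm := by
  induction h with
  | refl => exact IsTransport.refl _
  | @snoc P Q γ _ hQ ih =>
    have h1 := IsTransport.snoc (x := γ 1) (P := ContinuousLinearEquiv.refl ℝ (Tractor E))
      (fun t => γ (1 - t)) (by simpa using IsTransport.refl (g := g) (γ 1)) hQ.symm
    have h2 : IsTransport g (γ 1) (γ 0) Q.symm := by
      have h3 : (ContinuousLinearEquiv.refl ℝ (Tractor E)).trans Q.symm = Q.symm := by ext1; rfl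
      rw [h3] at h1
      simpa using h1
    exact h2.trans ih

/-- The conformal holonomy group `Hol_x(M, c)`, in the splitting given by `g ∈ c`: the group of
parallel transports of tractors along piecewise smooth loops at `x`. -/
def holonomyGroup (g : SemiRiemannianMetric E M p q) (x : M) :
    Subgroup (Tractor E ≃L[ℝ] Tractor E) where
  carrier := {P | IsTransport g x x P}
  one_mem' := IsTransport.refl x
  mul_mem' hP hQ := hQ.trans hP
  inv_mem' hP := hP.symm

/-- The Lie algebra of a Lie subgroup `H` of `GL(V)`: the velocities at the identity of smooth
curves of endomorphisms of `V` which stay in `H`. -/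
def lieAlgebra {V : Type*} [NormedAddCommGroup V] [NormedSpace ℝ V]
    (H : Subgroup (V ≃L[ℝ] V)) : Submodule ℝ (V →L[ℝ] V) where
  carrier := {A | ∃ c : ℝ → V →L[ℝ] V, ContDiff ℝ ∞ c ∧ (∀ t, ∃ P ∈ H, (P : V →L[ℝ] V) = c t) ∧
    c 0 = ContinuousLinearMap.id ℝ V ∧ HasDerivAt c A 0}
  zero_mem' := ⟨fun _ => ContinuousLinearMap.id ℝ V, contDiff_const,
    fun _ => ⟨1, H.one_mem, rfl⟩, rfl, hasDerivAt_const _ _⟩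
  add_mem' := by
    rintro A B ⟨c, hc, hcH, hc0, hcA⟩ ⟨d, hd, hdH, hd0, hdB⟩
    refine ⟨fun t => (c t).comp (d t), hc.clm_comp hd, fun t => ?_, ?_, ?_⟩
    · obtain ⟨P, hP, hPc⟩ := hcH t
      obtain ⟨Q, hQ, hQd⟩ := hdH t
      exact ⟨P * Q, H.mul_mem hP hQ, by simp only [← hPc, ← hQd]; rfl⟩
    · simp [hc0, hd0]
    · have := hcA.clm_comp hdB
      rw [hc0, hd0] at this
      simpa using this
  smul_mem' := by
    rintro a A ⟨c, hc, hcH, hc0, hcA⟩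
    refine ⟨fun t => c (a * t), hc.comp (contDiff_const.mul contDiff_id), fun t => hcH _,
      by simpa using hc0, ?_⟩
    have h1 : HasDerivAt (fun t : ℝ => a * t) a 0 := by
      simpa using (hasDerivAt_id (0 : ℝ)).const_mul a
    have h2 : HasDerivAt c A (a * 0) := by simpa using hcA
    exact h2.scomp 0 h1

/-- The conformal holonomy algebra `𝔥𝔬𝔩_x(M, c)`, in the splitting given by `g ∈ c`. -/
def holonomyAlgebra (g : SemiRiemannianMetric E M p q) (x : M) :
    Submodule ℝ (Tractor E →L[ℝ] Tractor E) :=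
  lieAlgebra (holonomyGroup g x)

/-- `𝔥𝔬𝔩_x(M, c)` is generic: it consists of all endomorphisms which are skew for the tractor
metric `h_x`, a form of signature `(p + 1, q + 1)`; that is, `𝔥𝔬𝔩_x(M, c) = 𝔰𝔬(p + 1, q + 1)`. -/
def IsGenericAt (g : SemiRiemannianMetric E M p q) (x : M) : Prop :=
  ∀ A : Tractor E →L[ℝ] Tractor E, A ∈ holonomyAlgebra g x ↔
    ∀ S T, tractorMetric g x (A S) T + tractorMetric g x S (A T) = 0

/-! ### The conformal holonomy distribution -/

variable (E) in
/-- The distinguished lightlike line `𝓘`, spanned by `s₋`. -/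
def tractorLine : Submodule ℝ (Tractor E) := Submodule.span ℝ {((1 : ℝ), (0 : E), (0 : ℝ))}

/-- `T ∈ 𝓘^⊥`. -/
def IsPerpLine (g : SemiRiemannianMetric E M p q) (x : M) (T : Tractor E) : Prop :=
  ∀ S ∈ tractorLine E, tractorMetric g x S T = 0

/-- `A 𝓘 = 0` and `h(A 𝓘^⊥, 𝓘^⊥) = 0`. -/
def IsTopDegree (g : SemiRiemannianMetric E M p q) (x : M)
    (A : Tractor E →L[ℝ] Tractor E) : Prop :=
  (∀ S ∈ tractorLine E, A S = 0) ∧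
    ∀ S T, IsPerpLine g x S → IsPerpLine g x T → tractorMetric g x (A S) T = 0

theorem IsTopDegree.apply_mid {g : SemiRiemannianMetric E M p q} {x : M}
    {A : Tractor E →L[ℝ] Tractor E} (h : IsTopDegree g x A) (T : Tractor E) :
    (A T).2.1 = T.2.2 • (A (0, 0, 1)).2.1 := by
  have hperp : ∀ (a : ℝ) (v : E), IsPerpLine g x (a, v, 0) := by
    intro a v S hS
    obtain ⟨r, rfl⟩ := Submodule.mem_span_singleton.1 hS
    simp [tractorMetric]
  have h0 : (A (T.1, T.2.1, 0)).2.1 = 0 := by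
    apply form_nondegenerate g x
    intro w
    have h2 := h.2 _ (0, w, 0) (hperp T.1 T.2.1) (hperp 0 w)
    simpa [tractorMetric] using h2
  have hT : T = (T.1, T.2.1, 0) + T.2.2 • ((0, 0, 1) : Tractor E) := by
    ext <;> simp
  conv_lhs => rw [hT]
  rw [map_add, map_smul]
  simp [h0]

/-- The conformal holonomy distribution at `x`,
`𝓔_x = {pr_{TM} Im A | A ∈ 𝔥𝔬𝔩_x(M, c), A 𝓘 = 0, h(A 𝓘^⊥, 𝓘^⊥) = 0} ⊆ T_x M`. -/
def holonomyDistribution (g : SemiRiemannianMetric E M p q) (x : M) : Submodule ℝ E where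
  carrier := {v | ∃ A ∈ holonomyAlgebra g x, IsTopDegree g x A ∧ ∃ T, (A T).2.1 = v}
  zero_mem' := ⟨0, Submodule.zero_mem _, ⟨by simp, by simp [tractorMetric]⟩, 0, by simp⟩
  add_mem' := by
    rintro _ _ ⟨A, hA, hA', T, rfl⟩ ⟨B, hB, hB', S, rfl⟩
    refine ⟨T.2.2 • A + S.2.2 • B, Submodule.add_mem _ (Submodule.smul_mem _ _ hA)
      (Submodule.smul_mem _ _ hB), ⟨fun U hU => ?_, fun U W hU hW => ?_⟩, (0, 0, 1), ?_⟩
    · simp [hA'.1 U hU, hB'.1 U hU]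
    · have h1 := hA'.2 U W hU hW
      have h2 := hB'.2 U W hU hW
      simp only [tractorMetric] at h1 h2
      simp only [tractorMetric, add_apply, smul_apply, Prod.fst_add, Prod.snd_add, Prod.smul_fst,
        Prod.smul_snd, map_add, map_smul, smul_eq_mul]
      linear_combination T.2.2 * h1 + S.2.2 * h2
    · rw [hA'.apply_mid T, hB'.apply_mid S]
      simp
  smul_mem' := by
    rintro a _ ⟨A, hA, hA', T, rfl⟩
    exact ⟨A, hA, hA', a • T, by simp⟩

/-- `r^𝓔(x) = dim 𝓔_x`. -/
def holonomyRank (g : SemiRiemannianMetric E M p q) (x : M) : ℕ :=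
  Module.finrank ℝ (holonomyDistribution g x)

/-- `U` is an `𝓔`-adapted open set: `r^𝓔` is constant on `U`, equal to `k`, and there are `k` smooth
pointwise linearly independent sections of `𝓔` over `U`. -/
def IsAdapted (g : SemiRiemannianMetric E M p q) (U : Set M) : Prop :=
  IsOpen U ∧ ∃ k : ℕ, (∀ x ∈ U, holonomyRank g x = k) ∧
    ∃ V : Fin k → ∀ x : M, TangentSpace 𝓘(ℝ, E) x,
      (∀ i, ContMDiffOn 𝓘(ℝ, E) 𝓘(ℝ, E).tangent ∞
        (fun x => (⟨x, V i x⟩ : TangentBundle 𝓘(ℝ, E) M)) U) ∧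
      ∀ x ∈ U, LinearIndependent ℝ (fun i => V i x) ∧ ∀ i, V i x ∈ holonomyDistribution g x

end Tractor

end ConformalHolonomy

end

/-!
Parallel transport conjugates the holonomy algebras into one another, so the covariant derivative
along a curve of a field of endomorphisms in the holonomy algebra stays in the holonomy algebra. A
vector `v` lies in `𝓔` exactly when `s₋ ∧ v` lies in the holonomy algebra, and differentiating
`s₋ ∧ V` along `γ` produces the bracket of `γ̇ ∧ s₊` with `s₋ ∧ V`, up to a further term `s₋ ∧ ∇V`.

If `𝓔 = TM` along a curve with `g(γ̇, γ̇) ≠ 0`, a field `V` with `V = γ̇` at a point of `γ` shows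
that the grading element of the tractor algebra is a holonomy element there, and differentiating the
grading element gives `γ̇ ∧ s₊`. Together with the `s₋ ∧ v` these elements generate the whole
orthogonal algebra, and genericity at one point spreads by parallel transport.

If `V` is a section of `𝓔` and `w ∈ 𝓔`, the bracket of the derivative of `s₋ ∧ V` in the direction
`X` with `s₋ ∧ w` shows `g(V, w) X ∈ 𝓔`. Hence `𝓔 = TM` wherever `𝓔` is not totally lightlike, and
on an adapted open set this carries over to a neighbourhood, where curves are available.
-/

open Function
open scoped Manifold ContDiff Topology

noncomputable section

namespace ConformalHolonomy

/-! ### Naturality of the Levi-Civita connection and of the Schouten tensor -/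

section InvertibleForms

variable {E : Type*} [NormedAddCommGroup E] [NormedSpace ℝ E]

theorem form_ext {B : E →L[ℝ] E →L[ℝ] ℝ} (hB : B.IsInvertible) {v w : E}
    (h : ∀ z, B v z = B w z) : v = w :=
  hB.injective (ContinuousLinearMap.ext h)

theorem isInvertible_of_nondegenerate [FiniteDimensional ℝ E] {B : E →L[ℝ] E →L[ℝ] ℝ}
    (hB : ∀ v, (∀ w, B v w = 0) → v = 0) : B.IsInvertible := by
  have hinj : Injective (B : E →ₗ[ℝ] E →L[ℝ] ℝ) :=
    LinearMap.ker_eq_bot.1 <| LinearMap.ker_eq_bot'.2 fun v hv =>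
      hB v fun w => DFunLike.congr_fun (F := E →L[ℝ] ℝ) hv w
  have hfin : Module.finrank ℝ E = Module.finrank ℝ (E →L[ℝ] ℝ) :=
    Subspace.dual_finrank_eq.symm.trans
      (LinearMap.toContinuousLinearMap : (E →ₗ[ℝ] ℝ) ≃ₗ[ℝ] E →L[ℝ] ℝ).finrank_eq
  exact ⟨(LinearEquiv.ofInjectiveOfFinrankEq _ hinj hfin).toContinuousLinearEquiv, rfl⟩

theorem eventually_isInvertible [CompleteSpace E] {F : Type*} [NormedAddCommGroup F]
    [NormedSpace ℝ F] {X : Type*} [TopologicalSpace X] {f : X → E →L[ℝ] F} {x : X}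
    (hf : ContinuousAt f x) (h : (f x).IsInvertible) : ∀ᶠ z in 𝓝 x, (f z).IsInvertible := by
  obtain ⟨e, he⟩ := h
  exact hf.eventually (he ▸ e.nhds)

theorem apply_raise [FiniteDimensional ℝ E] {B : E →L[ℝ] E →L[ℝ] ℝ} (hB : B.IsInvertible)
    (S : E →ₗ[ℝ] E →ₗ[ℝ] ℝ) (v w : E) : B (raise B S v) w = S v w :=
  DFunLike.congr_fun (hB.self_apply_inverse (LinearMap.toContinuousLinearMap (S v))) w

theorem christoffel_spec {G : E → E →L[ℝ] E →L[ℝ] ℝ} {u : E} (hG : (G u).IsInvertible)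
    (v w z : E) : G u (christoffel G u v w) z = christoffelLower G u v w z :=
  DFunLike.congr_fun (hG.self_apply_inverse (christoffelLower G u v w)) z

theorem contDiffAt_christoffel [CompleteSpace E] {G : E → E →L[ℝ] E →L[ℝ] ℝ} {u : E}
    {n : WithTop ℕ∞} (hG : (G u).IsInvertible) (h : ContDiffAt ℝ (n + 1) G u) :
    ContDiffAt ℝ n (christoffel G) u := by
  have hfderiv : ContDiffAt ℝ n (fderiv ℝ G) u := h.fderiv_right le_rfl
  have hinv : ContDiffAt ℝ n (fun x => (G x).inverse) u :=
    hG.contDiffAt_map_inverse.comp u (h.of_le le_self_add)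
  have hflip : ContDiffAt ℝ n (fun x => (fderiv ℝ G x).flip) u :=
    (ContinuousLinearMap.flipₗᵢ ℝ E E (E →L[ℝ] ℝ)).contDiff.contDiffAt.comp u hfderiv
  exact ((ContinuousLinearMap.compL ℝ E (E →L[ℝ] ℝ) E).contDiff.contDiffAt.comp u hinv).clm_comp
    (((hfderiv.add hflip).sub (contDiffAt_const.clm_comp hflip)).const_smul _)

end InvertibleForms

section LocalIsometry

variable {E F : Type*} [NormedAddCommGroup E] [NormedSpace ℝ E] [NormedAddCommGroup F]
  [NormedSpace ℝ F] {φ : E → F} {G : E → E →L[ℝ] E →L[ℝ] ℝ} {H : F → F →L[ℝ] F →L[ℝ] ℝ} {u : E}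

/-- The pullback `φ^* H` of a field `H` of bilinear forms. -/
def pullbackForm (φ : E → F) (H : F → F →L[ℝ] F →L[ℝ] ℝ) (u : E) : E →L[ℝ] E →L[ℝ] ℝ :=
  (H (φ u)).bilinearComp (fderiv ℝ φ u) (fderiv ℝ φ u)

theorem isInvertible_pullbackForm (hφ : (fderiv ℝ φ u).IsInvertible)
    (hH : (H (φ u)).IsInvertible) : (pullbackForm φ H u).IsInvertible := by
  obtain ⟨e, he⟩ := hφ
  obtain ⟨b, hb⟩ := hH
  refine ⟨e.trans (b.trans (e.symm.arrowCongr (.refl ℝ ℝ))), ?_⟩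
  ext v w
  simp [pullbackForm, ← he, ← hb]

theorem contDiffAt_pullbackForm {n : WithTop ℕ∞} (hφ : ContDiffAt ℝ (n + 1) φ u)
    (hH : ContDiffAt ℝ n H (φ u)) : ContDiffAt ℝ n (pullbackForm φ H) u := by
  have hfderiv : ContDiffAt ℝ n (fderiv ℝ φ) u := hφ.fderiv_right le_rfl
  have hflip := (ContinuousLinearMap.flipₗᵢ ℝ E F ℝ).contDiff.contDiffAt.comp u
    ((hH.comp u (hφ.of_le le_self_add)).clm_comp hfderiv)
  exact (ContinuousLinearMap.flipₗᵢ ℝ E E ℝ).contDiff.contDiffAt.comp u (hflip.clm_comp hfderiv)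

theorem fderiv_pullbackForm (hφ : ContDiffAt ℝ 2 φ u) (hH : ContDiffAt ℝ 1 H (φ u)) (v w z : E) :
    fderiv ℝ (pullbackForm φ H) u v w z =
      fderiv ℝ H (φ u) (fderiv ℝ φ u v) (fderiv ℝ φ u w) (fderiv ℝ φ u z)
      + H (φ u) (fderiv ℝ (fderiv ℝ φ) u v w) (fderiv ℝ φ u z)
      + H (φ u) (fderiv ℝ φ u w) (fderiv ℝ (fderiv ℝ φ) u v z) := by
  have hφ' : HasFDerivAt φ (fderiv ℝ φ u) u := (hφ.differentiableAt (by simp)).hasFDerivAt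
  have hφ'' : HasFDerivAt (fderiv ℝ φ) (fderiv ℝ (fderiv ℝ φ) u) u :=
    ((hφ.fderiv_right (m := 1) (by norm_num)).differentiableAt (by simp)).hasFDerivAt
  have hHφ : HasFDerivAt (fun x => H (φ x)) _ u :=
    (hH.differentiableAt (by simp)).hasFDerivAt.comp u hφ'
  have hpull : HasFDerivAt (pullbackForm φ H) _ u :=
    ((contDiffAt_pullbackForm (n := 1) (by norm_num; exact hφ) hH).differentiableAt
      (by simp)).hasFDerivAt
  have hconst (a : E) : HasFDerivAt (fun _ : E => a) (0 : E →L[ℝ] E) u := hasFDerivAt_const a u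
  have key := ((hpull.clm_apply (hconst w)).clm_apply (hconst z)).unique
    ((hHφ.clm_apply (hφ''.clm_apply (hconst w))).clm_apply (hφ''.clm_apply (hconst z)))
  simpa [add_comm, add_left_comm] using DFunLike.congr_fun key v

/-- Near `u`, the map `φ` is an isometry from the semi-Riemannian metric `G` to the semi-Riemannian
metric `H`. The orders of differentiability are those needed for the curvature to be natural. -/
structure IsLocalIsometryAt (φ : E → F) (G : E → E →L[ℝ] E →L[ℝ] ℝ) (H : F → F →L[ℝ] F →L[ℝ] ℝ)
    (u : E) : Prop where
  contDiffAt_map : ContDiffAt ℝ 3 φ u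
  contDiffAt_form : ContDiffAt ℝ 2 H (φ u)
  isInvertible_fderiv : (fderiv ℝ φ u).IsInvertible
  isInvertible_form : (H (φ u)).IsInvertible
  symm_form : ∀ᶠ x in 𝓝 (φ u), ∀ v w, H x v w = H x w v
  eq_pullbackForm : G =ᶠ[𝓝 u] pullbackForm φ H

namespace IsLocalIsometryAt

theorem form_apply (h : IsLocalIsometryAt φ G H u) (v w : E) :
    G u v w = H (φ u) (fderiv ℝ φ u v) (fderiv ℝ φ u w) := by
  rw [h.eq_pullbackForm.eq_of_nhds]; rfl

theorem isInvertible_source (h : IsLocalIsometryAt φ G H u) : (G u).IsInvertible :=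
  h.eq_pullbackForm.eq_of_nhds ▸
    isInvertible_pullbackForm h.isInvertible_fderiv h.isInvertible_form

theorem contDiffAt_source (h : IsLocalIsometryAt φ G H u) : ContDiffAt ℝ 2 G u :=
  (contDiffAt_pullbackForm (n := 2) h.contDiffAt_map h.contDiffAt_form).congr_of_eventuallyEq
    h.eq_pullbackForm

theorem eventually [CompleteSpace E] [CompleteSpace F] (h : IsLocalIsometryAt φ G H u) :
    ∀ᶠ x in 𝓝 u, IsLocalIsometryAt φ G H x := by
  have hφ : ContinuousAt φ u := h.contDiffAt_map.continuousAt
  have hφ' : ContinuousAt (fderiv ℝ φ) u :=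
    (h.contDiffAt_map.fderiv_right (m := 2) (by norm_num)).continuousAt
  have hH : ContinuousAt (fun x => H (φ x)) u :=
    ContinuousAt.comp (g := H) h.contDiffAt_form.continuousAt hφ
  filter_upwards [h.contDiffAt_map.eventually (by decide),
    hφ.eventually (h.contDiffAt_form.eventually (by decide)),
    eventually_isInvertible hφ' h.isInvertible_fderiv,
    eventually_isInvertible hH h.isInvertible_form,
    hφ.eventually h.symm_form.eventually_nhds, h.eq_pullbackForm.eventually_nhds]
    with x h₁ h₂ h₃ h₄ h₅ h₆ using ⟨h₁, h₂, h₃, h₄, h₅, h₆⟩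

theorem map_christoffel (h : IsLocalIsometryAt φ G H u) (v w : E) :
    fderiv ℝ φ u (christoffel G u v w) =
      christoffel H (φ u) (fderiv ℝ φ u v) (fderiv ℝ φ u w) + fderiv ℝ (fderiv ℝ φ) u v w := by
  have hφ : ContDiffAt ℝ 2 φ u := h.contDiffAt_map.of_le (by norm_num)
  have hH : ContDiffAt ℝ 1 H (φ u) := h.contDiffAt_form.of_le (by norm_num)
  have hsymm (a b : E) : fderiv ℝ (fderiv ℝ φ) u a b = fderiv ℝ (fderiv ℝ φ) u b a :=
    (hφ.isSymmSndFDerivAt (by simp)).eq a b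
  refine form_ext h.isInvertible_form fun z' => ?_
  obtain ⟨z, rfl⟩ := h.isInvertible_fderiv.surjective z'
  rw [← h.form_apply, christoffel_spec h.isInvertible_source, map_add, add_apply,
    christoffel_spec h.isInvertible_form, christoffelLower_apply, christoffelLower_apply,
    h.eq_pullbackForm.fderiv_eq, fderiv_pullbackForm hφ hH, fderiv_pullbackForm hφ hH,
    fderiv_pullbackForm hφ hH, hsymm w v, hsymm z v, hsymm z w,
    h.symm_form.self_of_nhds (fderiv ℝ φ u w)]
  ring

theorem map_fderiv_christoffel [CompleteSpace E] [CompleteSpace F]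
    (h : IsLocalIsometryAt φ G H u) (x v w : E) :
    fderiv ℝ φ u (fderiv ℝ (christoffel G) u x v w) =
      fderiv ℝ (christoffel H) (φ u) (fderiv ℝ φ u x) (fderiv ℝ φ u v) (fderiv ℝ φ u w)
        + christoffel H (φ u) (fderiv ℝ (fderiv ℝ φ) u x v) (fderiv ℝ φ u w)
        + christoffel H (φ u) (fderiv ℝ φ u v) (fderiv ℝ (fderiv ℝ φ) u x w)
        + fderiv ℝ (fderiv ℝ (fderiv ℝ φ)) u x v w
        - fderiv ℝ (fderiv ℝ φ) u x (christoffel G u v w) := by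
  have hφ' : ContDiffAt ℝ 2 (fderiv ℝ φ) u := h.contDiffAt_map.fderiv_right (by norm_num)
  have hφ'' : ContDiffAt ℝ 1 (fderiv ℝ (fderiv ℝ φ)) u := hφ'.fderiv_right (by norm_num)
  have hG : HasFDerivAt (christoffel G) _ u :=
    ((contDiffAt_christoffel (n := 1) h.isInvertible_source
      (by norm_num; exact h.contDiffAt_source)).differentiableAt (by simp)).hasFDerivAt
  have hH : HasFDerivAt (christoffel H) _ (φ u) :=
    ((contDiffAt_christoffel (n := 1) h.isInvertible_form
      (by norm_num; exact h.contDiffAt_form)).differentiableAt (by simp)).hasFDerivAt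
  have d₁ : HasFDerivAt φ _ u := (h.contDiffAt_map.differentiableAt (by simp)).hasFDerivAt
  have d₂ : HasFDerivAt (fderiv ℝ φ) _ u := (hφ'.differentiableAt (by simp)).hasFDerivAt
  have d₃ : HasFDerivAt (fderiv ℝ (fderiv ℝ φ)) _ u := (hφ''.differentiableAt (by simp)).hasFDerivAt
  have hconst (a : E) : HasFDerivAt (fun _ : E => a) (0 : E →L[ℝ] E) u := hasFDerivAt_const a u
  have hleft := d₂.clm_apply ((hG.clm_apply (hconst v)).clm_apply (hconst w))
  have hright := (((hH.comp u d₁).clm_apply (d₂.clm_apply (hconst v))).clm_apply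
    (d₂.clm_apply (hconst w))).add ((d₃.clm_apply (hconst v)).clm_apply (hconst w))
  have key := hleft.unique
    (hright.congr_of_eventuallyEq (h.eventually.mono fun y hy => hy.map_christoffel v w))
  have := DFunLike.congr_fun key x
  simp only [add_apply, ContinuousLinearMap.comp_apply, ContinuousLinearMap.flip_apply, zero_apply,
    map_zero, zero_add, Function.comp_apply] at this
  rw [eq_sub_iff_add_eq, this]
  abel

theorem map_curvature [CompleteSpace E] [CompleteSpace F] (h : IsLocalIsometryAt φ G H u)
    (v w z : E) :
    fderiv ℝ φ u (curvature G u w z v) =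
      curvature H (φ u) (fderiv ℝ φ u w) (fderiv ℝ φ u z) (fderiv ℝ φ u v) := by
  have hφ' : ContDiffAt ℝ 2 (fderiv ℝ φ) u := h.contDiffAt_map.fderiv_right (by norm_num)
  have hsymm₂ : fderiv ℝ (fderiv ℝ φ) u v w = fderiv ℝ (fderiv ℝ φ) u w v :=
    ((h.contDiffAt_map.of_le (by norm_num)).isSymmSndFDerivAt (n := 2) (by simp)).eq v w
  have hsymm₃ : fderiv ℝ (fderiv ℝ (fderiv ℝ φ)) u v w = fderiv ℝ (fderiv ℝ (fderiv ℝ φ)) u w v :=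
    (hφ'.isSymmSndFDerivAt (by simp)).eq v w
  simp only [curvature, LinearMap.coe_mk, AddHom.coe_mk, map_add, map_sub, h.map_christoffel,
    h.map_fderiv_christoffel, hsymm₂, hsymm₃]
  abel

theorem ricci_apply [CompleteSpace E] [CompleteSpace F] (h : IsLocalIsometryAt φ G H u)
    (w z : E) : ricci G u w z = ricci H (φ u) (fderiv ℝ φ u w) (fderiv ℝ φ u z) := by
  obtain ⟨e, he⟩ := h.isInvertible_fderiv
  change LinearMap.trace ℝ E _ = LinearMap.trace ℝ F _
  rw [← LinearMap.trace_conj' _ e.toLinearEquiv]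
  congr 1
  ext v
  have := h.map_curvature (e.symm v) w z
  rw [← he] at this ⊢
  simpa [LinearEquiv.conj_apply_apply] using this

end IsLocalIsometryAt

end LocalIsometry

section Schouten

variable {E F : Type*} [NormedAddCommGroup E] [NormedSpace ℝ E] [FiniteDimensional ℝ E]
  [NormedAddCommGroup F] [NormedSpace ℝ F] [FiniteDimensional ℝ F]

/-- The scalar curvature of the metric `G` at `u`. -/
def scalarCurvature (G : E → E →L[ℝ] E →L[ℝ] ℝ) (u : E) : ℝ :=
  LinearMap.trace ℝ E (raise (G u) (ricci G u))

/-- The Schouten tensor of the metric `G` at `u`, in dimension `p + q`. -/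
def schoutenTensor (p q : ℕ) (G : E → E →L[ℝ] E →L[ℝ] ℝ) (u : E) : E →ₗ[ℝ] E →ₗ[ℝ] ℝ :=
  (1 / ((p : ℝ) + q - 2)) • (ricci G u - (scalarCurvature G u / (2 * ((p : ℝ) + q - 1))) •
    (ContinuousLinearMap.coeLM ℝ ∘ₗ (G u : E →ₗ[ℝ] E →L[ℝ] ℝ)))

theorem map_raise {A : E →L[ℝ] F} {B : E →L[ℝ] E →L[ℝ] ℝ} {C : F →L[ℝ] F →L[ℝ] ℝ}
    {S : E →ₗ[ℝ] E →ₗ[ℝ] ℝ} {T : F →ₗ[ℝ] F →ₗ[ℝ] ℝ} (hA : Surjective A) (hB : B.IsInvertible)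
    (hC : C.IsInvertible) (hBC : ∀ v w, B v w = C (A v) (A w))
    (hST : ∀ v w, S v w = T (A v) (A w)) (v : E) : A (raise B S v) = raise C T (A v) := by
  refine form_ext hC fun z' => ?_
  obtain ⟨z, rfl⟩ := hA z'
  rw [← hBC, apply_raise hB, apply_raise hC, hST]

variable {φ : E → F} {G : E → E →L[ℝ] E →L[ℝ] ℝ} {H : F → F →L[ℝ] F →L[ℝ] ℝ} {u : E}

namespace IsLocalIsometryAt

theorem scalarCurvature_eq (h : IsLocalIsometryAt φ G H u) :
    scalarCurvature G u = scalarCurvature H (φ u) := by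
  obtain ⟨e, he⟩ := h.isInvertible_fderiv
  unfold scalarCurvature
  rw [← LinearMap.trace_conj' _ e.toLinearEquiv]
  congr 1
  ext v
  have := map_raise h.isInvertible_fderiv.surjective h.isInvertible_source h.isInvertible_form
    h.form_apply h.ricci_apply (e.symm v)
  rw [← he] at this
  simpa [LinearEquiv.conj_apply_apply] using this

theorem schoutenTensor_apply (p q : ℕ) (h : IsLocalIsometryAt φ G H u) (v w : E) :
    schoutenTensor p q G u v w =
      schoutenTensor p q H (φ u) (fderiv ℝ φ u v) (fderiv ℝ φ u w) := by
  simp [schoutenTensor, h.ricci_apply, h.scalarCurvature_eq, h.form_apply]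

end IsLocalIsometryAt

end Schouten

/-! ### The orthogonal algebra of the tractor fibre -/

attribute [local instance] LieRing.ofAssociativeRing

section SkewEndomorphisms

variable {V : Type*} [NormedAddCommGroup V] [NormedSpace ℝ V] {B : V →L[ℝ] V →L[ℝ] ℝ}

/-- `A` is skew for the bilinear form `B`, that is, `A ∈ 𝔰𝔬(V, B)`. -/
def IsSkewFor (B : V →L[ℝ] V →L[ℝ] ℝ) (A : V →L[ℝ] V) : Prop :=
  ∀ v w, B (A v) w + B v (A w) = 0

/-- The endomorphism `u ∧ v = B(v, ·) u - B(u, ·) v`. -/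
def rotation (B : V →L[ℝ] V →L[ℝ] ℝ) (u v : V) : V →L[ℝ] V :=
  (B v).smulRight u - (B u).smulRight v

theorem rotation_apply (B : V →L[ℝ] V →L[ℝ] ℝ) (u v w : V) :
    rotation B u v w = B v w • u - B u w • v := rfl

theorem rotation_self (B : V →L[ℝ] V →L[ℝ] ℝ) (u : V) : rotation B u u = 0 := sub_self _

theorem isSkewFor_rotation (hsymm : ∀ v w, B v w = B w v) (u v : V) :
    IsSkewFor B (rotation B u v) := fun w z => by
  simp only [rotation_apply, map_sub, map_smul, sub_apply, smul_apply, smul_eq_mul, hsymm w u,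
    hsymm w v]
  ring

theorem IsSkewFor.mem_span_rotation [FiniteDimensional ℝ V] (hsymm : ∀ v w, B v w = B w v)
    (hB : B.IsInvertible) {β : V →L[ℝ] V} (hβ : IsSkewFor B β) :
    β ∈ Submodule.span ℝ (range (uncurry (rotation B))) := by
  let b : LinearMap.BilinForm ℝ V := ContinuousLinearMap.coeLM ℝ ∘ₗ (B : V →ₗ[ℝ] V →L[ℝ] ℝ)
  have hb (v w : V) : b v w = B v w := rfl
  have hbsymm : b.IsSymm := ⟨hsymm⟩
  have hnd : b.Nondegenerate :=
    hbsymm.isRefl.nondegenerate_iff_separatingLeft.2 fun v hv =>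
      form_ext hB fun w => (hv w).trans (by simp)
  let e := Module.finBasis ℝ V
  let e' := b.dualBasis hnd e
  have hexp (Y : V) : ∑ i, B (e' i) Y • e i = Y := by
    conv_rhs => rw [← e.sum_repr Y]
    refine Finset.sum_congr rfl fun i _ => ?_
    rw [← hb, hbsymm.eq, ← b.dualBasis_repr_apply hnd e',
      b.dualBasis_dualBasis hnd hbsymm]
  have hexp' (Y : V) : ∑ i, B (e i) Y • e' i = Y := by
    conv_rhs => rw [← e'.sum_repr Y]
    exact Finset.sum_congr rfl fun i _ => by simp [e', hb, hsymm Y]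
  have key : β = (1 / 2 : ℝ) • ∑ i, rotation B (β (e i)) (e' i) := by
    ext Y
    have h₁ : ∑ i, B (e' i) Y • β (e i) = β Y := by simpa using congrArg β (hexp Y)
    have h₂ : ∑ i, B (β (e i)) Y • e' i = -β Y := by
      simp only [eq_neg_of_add_eq_zero_left (hβ _ _), neg_smul, Finset.sum_neg_distrib, hexp']
    simp only [smul_apply, sum_apply, rotation_apply, Finset.sum_sub_distrib, h₁, h₂]
    module
  rw [key]
  exact Submodule.smul_mem _ _ (Submodule.sum_mem _ fun i _ =>
    Submodule.subset_span (mem_range_self (β (e i), e' i)))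

end SkewEndomorphisms

section TractorOperators

variable {E : Type*} [NormedAddCommGroup E] [NormedSpace ℝ E] {B : E →L[ℝ] E →L[ℝ] ℝ}

variable (E) in
/-- The component of a tractor along `s₋`. -/
def topProj : Tractor E →L[ℝ] ℝ := .fst ℝ ℝ (E × ℝ)

variable (E) in
/-- The tangential component of a tractor. -/
def midProj : Tractor E →L[ℝ] E := .comp (.fst ℝ E ℝ) (.snd ℝ ℝ (E × ℝ))

variable (E) in
/-- The component of a tractor along `s₊`. -/
def botProj : Tractor E →L[ℝ] ℝ := .comp (.snd ℝ E ℝ) (.snd ℝ ℝ (E × ℝ))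

variable (E) in
/-- The inclusion of the tangent space into the tractor fibre. -/
def midIncl : E →L[ℝ] Tractor E := .comp (.inr ℝ ℝ (E × ℝ)) (.inl ℝ E ℝ)

/-- The tractor form `h` associated with a bilinear form `B` on the tangent space. -/
def tractorForm (B : E →L[ℝ] E →L[ℝ] ℝ) : Tractor E →L[ℝ] Tractor E →L[ℝ] ℝ :=
  (ContinuousLinearMap.mul ℝ ℝ).bilinearComp (topProj E) (botProj E) +
    (ContinuousLinearMap.mul ℝ ℝ).flip.bilinearComp (botProj E) (topProj E) +
    B.bilinearComp (midProj E) (midProj E)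

/-- The endomorphism `s₋ ∧ v` of the tractor fibre. -/
def raisingOp (B : E →L[ℝ] E →L[ℝ] ℝ) : E →ₗ[ℝ] Tractor E →L[ℝ] Tractor E where
  toFun v := (-(B v).comp (midProj E)).prod (((botProj E).smulRight v).prod 0)
  map_add' v w := ContinuousLinearMap.ext fun T => by simp [add_comm]
  map_smul' a v := ContinuousLinearMap.ext fun T => by simp [smul_comm a]

/-- The endomorphism `u ∧ s₊` of the tractor fibre. -/
def loweringOp (B : E →L[ℝ] E →L[ℝ] ℝ) : E →ₗ[ℝ] Tractor E →L[ℝ] Tractor E where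
  toFun u := .prod 0 (((topProj E).smulRight u).prod (-(B u).comp (midProj E)))
  map_add' u v := ContinuousLinearMap.ext fun T => by simp [add_comm]
  map_smul' a u := ContinuousLinearMap.ext fun T => by simp [smul_comm a]

/-- The endomorphism `0 ⊕ β ⊕ 0` of the tractor fibre. -/
def middleOp : (E →L[ℝ] E) →ₗ[ℝ] Tractor E →L[ℝ] Tractor E where
  toFun β := (0 : Tractor E →L[ℝ] ℝ).prod ((β.comp (midProj E)).prod 0)
  map_add' β δ := by ext <;> simp
  map_smul' a β := by ext <;> simp

variable (E) in
/-- The grading endomorphism of the tractor fibre. It acts by `1` on `s₋`, by `0` on the tangent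
space and by `-1` on `s₊`. -/
def gradingOp : Tractor E →L[ℝ] Tractor E :=
  (topProj E).prod ((0 : Tractor E →L[ℝ] E).prod (-botProj E))

theorem tractorForm_apply (B : E →L[ℝ] E →L[ℝ] ℝ) (S T : Tractor E) :
    tractorForm B S T = S.1 * T.2.2 + T.1 * S.2.2 + B S.2.1 T.2.1 := rfl

theorem raisingOp_apply (B : E →L[ℝ] E →L[ℝ] ℝ) (v : E) (T : Tractor E) :
    raisingOp B v T = (-B v T.2.1, T.2.2 • v, 0) := rfl

theorem loweringOp_apply (B : E →L[ℝ] E →L[ℝ] ℝ) (u : E) (T : Tractor E) :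
    loweringOp B u T = (0, T.1 • u, -B u T.2.1) := rfl

theorem middleOp_apply (β : E →L[ℝ] E) (T : Tractor E) : middleOp β T = (0, β T.2.1, 0) := rfl

theorem gradingOp_apply (T : Tractor E) : gradingOp E T = (T.1, 0, -T.2.2) := rfl

theorem isSkewFor_raisingOp (hsymm : ∀ v w, B v w = B w v) (v : E) :
    IsSkewFor (tractorForm B) (raisingOp B v) := fun S T => by
  simp only [tractorForm_apply, raisingOp_apply, map_smul, smul_apply, smul_eq_mul, hsymm _ v]
  ring

theorem lie_raisingOp_raisingOp (hsymm : ∀ v w, B v w = B w v) (v w : E) :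
    ⁅raisingOp B v, raisingOp B w⁆ = 0 := by
  ext T <;> simp [Ring.lie_def, raisingOp_apply, hsymm v w]

theorem lie_raisingOp_loweringOp (hsymm : ∀ v w, B v w = B w v) (v u : E) :
    ⁅raisingOp B v, loweringOp B u⁆ = middleOp (rotation B u v) - B u v • gradingOp E := by
  ext T <;> simp [Ring.lie_def, raisingOp_apply, loweringOp_apply, middleOp_apply, rotation_apply,
    gradingOp_apply, hsymm v u, neg_add_eq_sub]

theorem lie_gradingOp_raisingOp (B : E →L[ℝ] E →L[ℝ] ℝ) (v : E) :
    ⁅gradingOp E, raisingOp B v⁆ = raisingOp B v := by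
  ext T <;> simp [Ring.lie_def, raisingOp_apply, gradingOp_apply]

theorem lie_gradingOp_loweringOp (B : E →L[ℝ] E →L[ℝ] ℝ) (u : E) :
    ⁅gradingOp E, loweringOp B u⁆ = -loweringOp B u := by
  ext T <;> simp [Ring.lie_def, loweringOp_apply, gradingOp_apply]

theorem lie_gradingOp_middleOp (β : E →L[ℝ] E) : ⁅gradingOp E, middleOp β⁆ = 0 := by
  ext T <;> simp [Ring.lie_def, middleOp_apply, gradingOp_apply]

theorem lie_middleOp_raisingOp {β : E →L[ℝ] E} (hβ : IsSkewFor B β) (v : E) :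
    ⁅middleOp β, raisingOp B v⁆ = raisingOp B (β v) := by
  ext T <;> simp [Ring.lie_def, raisingOp_apply, middleOp_apply,
    eq_neg_of_add_eq_zero_right (hβ _ _)]

theorem lie_middleOp_loweringOp {β : E →L[ℝ] E} (hβ : IsSkewFor B β) (u : E) :
    ⁅middleOp β, loweringOp B u⁆ = loweringOp B (β u) := by
  ext T <;> simp [Ring.lie_def, loweringOp_apply, middleOp_apply,
    eq_neg_of_add_eq_zero_right (hβ _ _)]

section Decomposition

variable {A : Tractor E →L[ℝ] Tractor E}

theorem IsSkewFor.middle (hA : IsSkewFor (tractorForm B) A) :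
    IsSkewFor B ((midProj E).comp (A.comp (midIncl E))) := fun v w => by
  simpa [tractorForm_apply, midProj, midIncl] using hA (0, v, 0) (0, w, 0)

theorem IsSkewFor.eq_add (hsymm : ∀ v w, B v w = B w v) (hA : IsSkewFor (tractorForm B) A) :
    A = raisingOp B (A (0, 0, 1)).2.1 + loweringOp B (A (1, 0, 0)).2.1 +
      (A (1, 0, 0)).1 • gradingOp E + middleOp ((midProj E).comp (A.comp (midIncl E))) := by
  have h₁₁ := hA (1, 0, 0) (1, 0, 0)
  have h₁₃ := hA (1, 0, 0) (0, 0, 1)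
  have h₃₃ := hA (0, 0, 1) (0, 0, 1)
  have h₂₁ (Y : E) := hA (0, Y, 0) (1, 0, 0)
  have h₂₃ (Y : E) := hA (0, Y, 0) (0, 0, 1)
  simp only [tractorForm_apply, mul_one, one_mul, mul_zero, zero_mul, map_zero, zero_apply,
    add_zero, zero_add] at h₁₁ h₁₃ h₃₃ h₂₁ h₂₃
  have hdecomp (T : Tractor E) : T = T.1 • (1, 0, 0) + (0, T.2.1, 0) + T.2.2 • (0, 0, 1) := by
    ext <;> simp
  refine ContinuousLinearMap.ext fun T => ?_
  have hT := congrArg A (hdecomp T)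
  rw [map_add, map_add, map_smul, map_smul] at hT
  rw [hT]
  simp only [add_apply, smul_apply, raisingOp_apply, loweringOp_apply, gradingOp_apply,
    middleOp_apply]
  refine Prod.ext ?_ (Prod.ext ?_ ?_)
  · simp only [Prod.fst_add, Prod.smul_fst, smul_eq_mul]
    linear_combination h₂₃ T.2.1 + T.2.2 / 2 * h₃₃ - hsymm T.2.1 (A (0, 0, 1)).2.1
  · simp [midProj, midIncl]
    abel
  · simp only [Prod.snd_add, Prod.smul_snd, smul_eq_mul]
    linear_combination h₂₁ T.2.1 + T.1 / 2 * h₁₁ + T.2.2 * h₁₃ - hsymm T.2.1 (A (1, 0, 0)).2.1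

end Decomposition

theorem IsSkewFor.mem_lieSubalgebra [FiniteDimensional ℝ E] (hsymm : ∀ v w, B v w = B w v)
    (hB : B.IsInvertible) {L : LieSubalgebra ℝ (Tractor E →L[ℝ] Tractor E)}
    (hraise : ∀ v, raisingOp B v ∈ L) (hgrading : gradingOp E ∈ L) {X : E} (hX : B X X ≠ 0)
    (hlower : loweringOp B X ∈ L) {A : Tractor E →L[ℝ] Tractor E}
    (hA : IsSkewFor (tractorForm B) A) : A ∈ L := by
  have hrot (u : E) (hu : loweringOp B u ∈ L) (v : E) : middleOp (rotation B u v) ∈ L := by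
    have h := L.lie_mem (hraise v) hu
    rw [lie_raisingOp_loweringOp hsymm] at h
    simpa using add_mem h (L.smul_mem (B u v) hgrading)
  have hlower' (v : E) : loweringOp B v ∈ L := by
    have h := L.lie_mem (hrot X hlower v) hlower
    rw [lie_middleOp_loweringOp (isSkewFor_rotation hsymm X v), rotation_apply, map_sub, map_smul,
      map_smul] at h
    have h' := sub_mem (L.smul_mem (B v X) hlower) h
    rw [sub_sub_cancel] at h'
    exact (L.toSubmodule.smul_mem_iff hX).1 h'
  have hmiddle : ∀ β ∈ Submodule.span ℝ (range (uncurry (rotation B))), middleOp β ∈ L := by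
    change Submodule.span _ _ ≤ L.toSubmodule.comap middleOp
    rw [Submodule.span_le]
    rintro _ ⟨⟨u, v⟩, rfl⟩
    exact hrot u (hlower' u) v
  rw [hA.eq_add hsymm]
  exact add_mem (add_mem (add_mem (hraise _) (hlower' _)) (L.smul_mem _ hgrading))
    (hmiddle _ (hA.middle.mem_span_rotation hsymm hB))

end TractorOperators

/-! ### The normal tractor connection of a metric on a vector space -/

section Smoothness

variable {E : Type*} [NormedAddCommGroup E] [NormedSpace ℝ E] [FiniteDimensional ℝ E]

theorem contDiffAt_clm_of_apply {F V : Type*} [NormedAddCommGroup F] [NormedSpace ℝ F]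
    [NormedAddCommGroup V] [NormedSpace ℝ V] {n : WithTop ℕ∞} {f : V → E →L[ℝ] F} {a : V}
    (h : ∀ v, ContDiffAt ℝ n (fun u => f u v) a) : ContDiffAt ℝ n f a := by
  let e₁ := ContinuousLinearEquiv.ofFinrankEq (Module.finrank_fin_fun (n := Module.finrank ℝ E) ℝ)
  let e₂ := (e₁.symm.arrowCongr (.refl ℝ F)).trans (ContinuousLinearEquiv.piRing _)
  rw [← id_comp f, ← e₂.symm_comp_self]
  exact e₂.symm.contDiff.contDiffAt.comp a (contDiffAt_pi.mpr fun i => h _)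

theorem hasDerivAt_clm_of_apply {F : Type*} [NormedAddCommGroup F] [NormedSpace ℝ F]
    {f : ℝ → E →L[ℝ] F} {f' : E →L[ℝ] F} {t : ℝ}
    (h : ∀ v, HasDerivAt (fun s => f s v) (f' v) t) : HasDerivAt f f' t := by
  let e₁ := ContinuousLinearEquiv.ofFinrankEq (Module.finrank_fin_fun (n := Module.finrank ℝ E) ℝ)
  let e₂ := (e₁.symm.arrowCongr (.refl ℝ F)).trans (ContinuousLinearEquiv.piRing _)
  rw [← id_comp f, ← e₂.symm_comp_self, ← e₂.symm_apply_apply f']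
  exact e₂.symm.hasFDerivAt.comp_hasDerivAt t (hasDerivAt_pi.2 fun i => h _)

theorem contDiffAt_trace {V : Type*} [NormedAddCommGroup V] [NormedSpace ℝ V] {n : WithTop ℕ∞}
    {f : V → E →ₗ[ℝ] E} {a : V} (h : ∀ v, ContDiffAt ℝ n (fun u => f u v) a) :
    ContDiffAt ℝ n (fun u => LinearMap.trace ℝ E (f u)) a := by
  have hf : ContDiffAt ℝ n (fun u => LinearMap.toContinuousLinearMap (f u)) a :=
    contDiffAt_clm_of_apply h
  let tr : (E →L[ℝ] E) →L[ℝ] ℝ :=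
    LinearMap.toContinuousLinearMap (LinearMap.trace ℝ E ∘ₗ ContinuousLinearMap.coeLM ℝ)
  exact tr.contDiff.contDiffAt.comp a hf

variable {G : E → E →L[ℝ] E →L[ℝ] ℝ} {u : E} {n : WithTop ℕ∞}

theorem contDiffAt_ricci (hG : (G u).IsInvertible) (h : ContDiffAt ℝ (n + 2) G u) (w z : E) :
    ContDiffAt ℝ n (fun u => ricci G u w z) u := by
  have hΓ : ContDiffAt ℝ (n + 1) (christoffel G) u :=
    contDiffAt_christoffel hG (by rwa [add_assoc, one_add_one_eq_two])
  have hΓ' : ContDiffAt ℝ n (fderiv ℝ (christoffel G)) u := hΓ.fderiv_right le_rfl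
  have hΓ₀ : ContDiffAt ℝ n (christoffel G) u := hΓ.of_le le_self_add
  have hderiv (a b c : E) : ContDiffAt ℝ n (fun u => fderiv ℝ (christoffel G) u a b c) u :=
    ((hΓ'.clm_apply contDiffAt_const).clm_apply contDiffAt_const).clm_apply contDiffAt_const
  have hquad (a b c : E) :
      ContDiffAt ℝ n (fun u => christoffel G u a (christoffel G u b c)) u :=
    (hΓ₀.clm_apply contDiffAt_const).clm_apply
      ((hΓ₀.clm_apply contDiffAt_const).clm_apply contDiffAt_const)
  exact contDiffAt_trace fun v =>
    (((hderiv _ _ _).sub (hderiv _ _ _)).add (hquad _ _ _)).sub (hquad _ _ _)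

theorem contDiffAt_raise (hG : (G u).IsInvertible) (h : ContDiffAt ℝ n G u)
    {S : E → E →ₗ[ℝ] E →ₗ[ℝ] ℝ} {v : E} (hS : ∀ w, ContDiffAt ℝ n (fun u => S u v w) u) :
    ContDiffAt ℝ n (fun u => raise (G u) (S u) v) u := by
  have hinv : ContDiffAt ℝ n (fun u => (G u).inverse) u := hG.contDiffAt_map_inverse.comp u h
  have hSv : ContDiffAt ℝ n (fun u => LinearMap.toContinuousLinearMap (S u v)) u :=
    contDiffAt_clm_of_apply hS
  exact hinv.clm_apply hSv

theorem contDiffAt_schoutenTensor (p q : ℕ) (hG : (G u).IsInvertible)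
    (h : ContDiffAt ℝ (n + 2) G u) (w z : E) :
    ContDiffAt ℝ n (fun u => schoutenTensor p q G u w z) u := by
  have h₀ : ContDiffAt ℝ n G u := h.of_le le_self_add
  have hscal : ContDiffAt ℝ n (scalarCurvature G) u :=
    contDiffAt_trace fun v => contDiffAt_raise hG h₀ (contDiffAt_ricci hG h v)
  exact contDiffAt_const.mul ((contDiffAt_ricci hG h w z).sub ((hscal.div_const _).mul
    ((h₀.clm_apply contDiffAt_const).clm_apply contDiffAt_const)))

end Smoothness

section TractorMap

variable {E F : Type*} [NormedAddCommGroup E] [NormedSpace ℝ E] [NormedAddCommGroup F]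
  [NormedSpace ℝ F]

/-- The map `(α, Y, β) ↦ (α, A Y, β)` of tractor fibres induced by `A`. -/
def tractorMap (A : E →L[ℝ] F) : Tractor E →L[ℝ] Tractor F :=
  (ContinuousLinearMap.id ℝ ℝ).prodMap (A.prodMap (ContinuousLinearMap.id ℝ ℝ))

theorem tractorMap_apply (A : E →L[ℝ] F) (T : Tractor E) :
    tractorMap A T = (T.1, A T.2.1, T.2.2) := rfl

theorem hasDerivAt_tractor_iff {T : ℝ → Tractor E} {T' : Tractor E} {t : ℝ} :
    HasDerivAt T T' t ↔ HasDerivAt (fun s => (T s).1) T'.1 t ∧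
      HasDerivAt (fun s => (T s).2.1) T'.2.1 t ∧ HasDerivAt (fun s => (T s).2.2) T'.2.2 t :=
  ⟨fun h => ⟨h.fst, h.snd.fst, h.snd.snd⟩, fun h => h.1.prodMk (h.2.1.prodMk h.2.2)⟩

theorem fderiv_form_eq_christoffel_add {G : E → E →L[ℝ] E →L[ℝ] ℝ} {u : E}
    (h : DifferentiableAt ℝ G u) (hG : (G u).IsInvertible)
    (hsymm : ∀ᶠ x in 𝓝 u, ∀ v w, G x v w = G x w v) (X v w : E) :
    fderiv ℝ G u X v w = G u (christoffel G u X v) w + G u v (christoffel G u X w) := by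
  have hconst (a : E) : HasFDerivAt (fun _ : E => a) (0 : E →L[ℝ] E) u := hasFDerivAt_const a u
  have hsymm' (a b c : E) : fderiv ℝ G u a b c = fderiv ℝ G u a c b := by
    have hbc := (h.hasFDerivAt.clm_apply (hconst b)).clm_apply (hconst c)
    have hcb := (h.hasFDerivAt.clm_apply (hconst c)).clm_apply (hconst b)
    simpa using DFunLike.congr_fun
      (hbc.unique (hcb.congr_of_eventuallyEq (hsymm.mono fun x hx => hx b c))) a
  rw [hsymm.self_of_nhds v, christoffel_spec hG, christoffel_spec hG, christoffelLower_apply,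
    christoffelLower_apply, hsymm' X w v]
  ring

end TractorMap

section ConnectionForm

variable {E F : Type*} [NormedAddCommGroup E] [NormedSpace ℝ E] [FiniteDimensional ℝ E]
  [NormedAddCommGroup F] [NormedSpace ℝ F] [FiniteDimensional ℝ F] {p q : ℕ}
  {G : E → E →L[ℝ] E →L[ℝ] ℝ} {u : E}

/-- The connection form `𝒜(X) = Γ(X) + X ∧ s₊ + s₋ ∧ P(X)` of the normal tractor connection
`∇_X = D_X + 𝒜(X)` of the metric `G`. -/
def connectionForm (p q : ℕ) (G : E → E →L[ℝ] E →L[ℝ] ℝ) (u : E) :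
    E →L[ℝ] Tractor E →L[ℝ] Tractor E :=
  LinearMap.toContinuousLinearMap (middleOp ∘ₗ (christoffel G u : E →ₗ[ℝ] E →L[ℝ] E) +
    loweringOp (G u) + raisingOp (G u) ∘ₗ raise (G u) (schoutenTensor p q G u))

theorem connectionForm_eq (p q : ℕ) (G : E → E →L[ℝ] E →L[ℝ] ℝ) (u X : E) :
    connectionForm p q G u X = middleOp (christoffel G u X) + loweringOp (G u) X +
      raisingOp (G u) (raise (G u) (schoutenTensor p q G u) X) := rfl

theorem connectionForm_apply (hG : (G u).IsInvertible) (X : E) (T : Tractor E) :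
    connectionForm p q G u X T = (-schoutenTensor p q G u X T.2.1,
      christoffel G u X T.2.1 + T.1 • X + T.2.2 • raise (G u) (schoutenTensor p q G u) X,
      -G u X T.2.1) := by
  simp [connectionForm_eq, middleOp_apply, loweringOp_apply, raisingOp_apply, apply_raise hG]

theorem contDiffAt_connectionForm {n : WithTop ℕ∞} (p q : ℕ) (hG : (G u).IsInvertible)
    (h : ContDiffAt ℝ (n + 2) G u) : ContDiffAt ℝ n (connectionForm p q G) u := by
  have h₀ : ContDiffAt ℝ n G u := h.of_le le_self_add
  have hΓ : ContDiffAt ℝ n (christoffel G) u :=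
    (contDiffAt_christoffel (n := n + 1) hG (by rwa [add_assoc, one_add_one_eq_two])).of_le
      le_self_add
  refine contDiffAt_clm_of_apply fun X => contDiffAt_clm_of_apply fun T => ?_
  have hP : ContDiffAt ℝ n (fun u => raise (G u) (schoutenTensor p q G u) X) u :=
    contDiffAt_raise hG h₀ (contDiffAt_schoutenTensor p q hG h X)
  simp only [connectionForm_eq, add_apply, middleOp_apply, loweringOp_apply, raisingOp_apply]
  exact ((contDiffAt_const.prodMk
    (((hΓ.clm_apply contDiffAt_const).clm_apply contDiffAt_const).prodMk contDiffAt_const)).add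
    (contDiffAt_const.prodMk (contDiffAt_const.prodMk
      ((h₀.clm_apply contDiffAt_const).clm_apply contDiffAt_const).neg))).add
    (((h₀.clm_apply hP).clm_apply contDiffAt_const).neg.prodMk
      ((contDiffAt_const.smul hP).prodMk contDiffAt_const))

theorem hasDerivAt_tractorForm_of_parallel {c : ℝ → E} {S T : ℝ → Tractor E} {X : E} {t : ℝ}
    (h : DifferentiableAt ℝ G (c t)) (hG : (G (c t)).IsInvertible)
    (hsymm : ∀ᶠ x in 𝓝 (c t), ∀ v w, G x v w = G x w v) (hc : HasDerivAt c X t)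
    (hS : HasDerivAt S (-connectionForm p q G (c t) X (S t)) t)
    (hT : HasDerivAt T (-connectionForm p q G (c t) X (T t)) t) :
    HasDerivAt (fun s => tractorForm (G (c s)) (S s) (T s)) 0 t := by
  have hGc : HasDerivAt (fun s => G (c s)) _ t := h.hasFDerivAt.comp_hasDerivAt t hc
  obtain ⟨hS₁, hS₂, hS₃⟩ := hasDerivAt_tractor_iff.1 hS
  obtain ⟨hT₁, hT₂, hT₃⟩ := hasDerivAt_tractor_iff.1 hT
  refine (((hS₁.mul hT₃).add (hT₁.mul hS₃)).add
    ((hGc.clm_apply hS₂).clm_apply hT₂)).congr_deriv ?_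
  simp only [connectionForm_apply hG, fderiv_form_eq_christoffel_add h hG hsymm, Prod.fst_neg,
    Prod.snd_neg, neg_neg, neg_add_rev, map_neg, map_add, map_smul, add_apply, neg_apply,
    smul_apply, smul_eq_mul, apply_raise hG, hsymm.self_of_nhds (S t).2.1]
  ring

theorem IsLocalIsometryAt.tractorMap_connectionForm {φ : E → F} {H : F → F →L[ℝ] F →L[ℝ] ℝ}
    (h : IsLocalIsometryAt φ G H u) (X : E) (T : Tractor E) :
    tractorMap (fderiv ℝ φ u) (connectionForm p q G u X T) =
      connectionForm p q H (φ u) (fderiv ℝ φ u X) (tractorMap (fderiv ℝ φ u) T) +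
        (0, fderiv ℝ (fderiv ℝ φ) u X T.2.1, 0) := by
  rw [connectionForm_apply h.isInvertible_source, connectionForm_apply h.isInvertible_form]
  refine Prod.ext ?_ (Prod.ext ?_ ?_)
  · simp [tractorMap_apply, h.schoutenTensor_apply]
  · simp only [tractorMap_apply, map_add, map_smul, h.map_christoffel, Prod.snd_add, Prod.fst_add,
      map_raise h.isInvertible_fderiv.surjective h.isInvertible_source h.isInvertible_form
        h.form_apply (h.schoutenTensor_apply p q)]
    abel
  · simp [tractorMap_apply, h.form_apply]

theorem IsLocalIsometryAt.hasDerivAt_tractorMap {φ : E → F} {H : F → F →L[ℝ] F →L[ℝ] ℝ}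
    {c : ℝ → E} {T : ℝ → Tractor E} {X : E} {t : ℝ} (h : IsLocalIsometryAt φ G H (c t))
    (hc : HasDerivAt c X t) (hT : HasDerivAt T (-connectionForm p q G (c t) X (T t)) t) :
    HasDerivAt (fun s => tractorMap (fderiv ℝ φ (c s)) (T s))
      (-connectionForm p q H (φ (c t)) (fderiv ℝ φ (c t) X)
        (tractorMap (fderiv ℝ φ (c t)) (T t))) t := by
  have hφ : HasDerivAt (fun s => fderiv ℝ φ (c s)) (fderiv ℝ (fderiv ℝ φ) (c t) X) t :=
    ((h.contDiffAt_map.fderiv_right (m := 2) (by norm_num)).differentiableAt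
      (by simp)).hasFDerivAt.comp_hasDerivAt t hc
  obtain ⟨hT₁, hT₂, hT₃⟩ := hasDerivAt_tractor_iff.1 hT
  refine (hT₁.prodMk ((hφ.clm_apply hT₂).prodMk hT₃)).congr_deriv ?_
  have key := h.tractorMap_connectionForm (p := p) (q := q) X (T t)
  rw [← sub_eq_iff_eq_add] at key
  rw [← key, tractorMap_apply]
  simp [sub_eq_add_neg, add_comm]

end ConnectionForm

/-! ### Tractors in charts -/

section Transition

variable {E : Type*} [NormedAddCommGroup E] [NormedSpace ℝ E]
  {M : Type*} [TopologicalSpace M] [ChartedSpace E M] {x y z : M}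

/-- The transition map from the coordinates of the preferred chart at `x` to those at `y`. -/
def transition (x y : M) : E → E := extChartAt 𝓘(ℝ, E) y ∘ (extChartAt 𝓘(ℝ, E) x).symm

theorem transition_apply (hx : z ∈ (extChartAt 𝓘(ℝ, E) x).source) :
    transition x y (extChartAt 𝓘(ℝ, E) x z) = extChartAt 𝓘(ℝ, E) y z := by
  rw [transition, comp_apply, (extChartAt 𝓘(ℝ, E) x).left_inv hx]

theorem eventually_exists_extChartAt_eq (hx : z ∈ (extChartAt 𝓘(ℝ, E) x).source) {U : Set M}
    (hU : U ∈ 𝓝 z) : ∀ᶠ u in 𝓝 (extChartAt 𝓘(ℝ, E) x z),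
      ∃ ζ ∈ (extChartAt 𝓘(ℝ, E) x).source ∩ U, extChartAt 𝓘(ℝ, E) x ζ = u := by
  have hxt := (extChartAt 𝓘(ℝ, E) x).map_source hx
  filter_upwards [(isOpen_extChartAt_target x).mem_nhds hxt,
    continuousAt_extChartAt_symm'' hxt (by rwa [(extChartAt 𝓘(ℝ, E) x).left_inv hx])] with u hu huU
  exact ⟨_, ⟨(extChartAt 𝓘(ℝ, E) x).map_target hu, huU⟩, (extChartAt 𝓘(ℝ, E) x).right_inv hu⟩

/-- The curve through `x` with initial velocity `X` which is a straight line in the preferred chart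
at `x`, as long as this line stays in the range of the chart. -/
def chartLine (x : M) (X : E) (t : ℝ) : M :=
  (extChartAt 𝓘(ℝ, E) x).symm (extChartAt 𝓘(ℝ, E) x x + t • X)

theorem chartLine_zero (x : M) (X : E) : chartLine x X 0 = x := by
  rw [chartLine, zero_smul, add_zero, extChartAt_to_inv]

variable [IsManifold 𝓘(ℝ, E) ∞ M]

theorem contDiffAt_transition (hx : z ∈ (extChartAt 𝓘(ℝ, E) x).source)
    (hy : z ∈ (extChartAt 𝓘(ℝ, E) y).source) :
    ContDiffAt ℝ ∞ (transition x y) (extChartAt 𝓘(ℝ, E) x z) := by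
  have hmem : extChartAt 𝓘(ℝ, E) x z ∈
      ((extChartAt 𝓘(ℝ, E) x).symm ≫ extChartAt 𝓘(ℝ, E) y).source := by
    rw [PartialEquiv.trans_source'', PartialEquiv.symm_symm, PartialEquiv.symm_target]
    exact mem_image_of_mem _ ⟨hx, hy⟩
  have h := contDiffWithinAt_ext_coord_change (I := 𝓘(ℝ, E)) (n := ∞) y x hmem
  rwa [ModelWithCorners.range_eq_univ, contDiffWithinAt_univ] at h

theorem fderiv_transition (x y z : M) :
    fderiv ℝ (transition x y) (extChartAt 𝓘(ℝ, E) x z) = tangentCoordChange 𝓘(ℝ, E) x y z := by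
  rw [tangentCoordChange_def, ModelWithCorners.range_eq_univ, fderivWithin_univ, transition]

theorem tangentCoordChange_tangentCoordChange (hx : z ∈ (extChartAt 𝓘(ℝ, E) x).source)
    (hy : z ∈ (extChartAt 𝓘(ℝ, E) y).source) (v : E) :
    tangentCoordChange 𝓘(ℝ, E) y x z (tangentCoordChange 𝓘(ℝ, E) x y z v) = v := by
  rw [tangentCoordChange_comp ⟨⟨hx, hy⟩, hx⟩, tangentCoordChange_self hx]

theorem isInvertible_tangentCoordChange (hx : z ∈ (extChartAt 𝓘(ℝ, E) x).source)
    (hy : z ∈ (extChartAt 𝓘(ℝ, E) y).source) : (tangentCoordChange 𝓘(ℝ, E) x y z).IsInvertible :=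
  ⟨.equivOfInverse _ (tangentCoordChange 𝓘(ℝ, E) y x z)
    (tangentCoordChange_tangentCoordChange hx hy)
    (tangentCoordChange_tangentCoordChange hy hx), rfl⟩

theorem hasDerivAt_extChartAt_comp {γ : ℝ → M} {t : ℝ}
    (hγ : MDifferentiableAt 𝓘(ℝ, ℝ) 𝓘(ℝ, E) γ t) (hy : γ t ∈ (extChartAt 𝓘(ℝ, E) y).source) :
    HasDerivAt (fun s => extChartAt 𝓘(ℝ, E) y (γ s))
      (tangentCoordChange 𝓘(ℝ, E) (γ t) y (γ t) (velocity γ t)) t := by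
  have hx := mem_extChartAt_source (I := 𝓘(ℝ, E)) (γ t)
  have hself : HasDerivAt (fun s => extChartAt 𝓘(ℝ, E) (γ t) (γ s)) (velocity γ t) t := by
    -- Naming the derivative hides the `TangentSpace` types, which block the rewriting.
    obtain ⟨D, hD⟩ : ∃ D : ℝ →L[ℝ] E, D = mfderiv 𝓘(ℝ, ℝ) 𝓘(ℝ, E) γ t := ⟨_, rfl⟩
    have h : HasFDerivWithinAt (fun s => extChartAt 𝓘(ℝ, E) (γ t) (γ s)) D (range 𝓘(ℝ, ℝ)) t :=
      hD ▸ hγ.hasMFDerivAt.2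
    rw [ModelWithCorners.range_eq_univ, hasFDerivWithinAt_univ] at h
    refine h.hasDerivAt.congr_deriv ?_
    rw [hD]
    rfl
  have htrans : HasFDerivAt (transition (γ t) y) (tangentCoordChange 𝓘(ℝ, E) (γ t) y (γ t))
      (extChartAt 𝓘(ℝ, E) (γ t) (γ t)) :=
    fderiv_transition (E := E) (γ t) y (γ t) ▸
      ((contDiffAt_transition hx hy).differentiableAt (by simp)).hasFDerivAt
  refine (htrans.comp_hasDerivAt t hself).congr_of_eventuallyEq ?_
  filter_upwards [hγ.continuousAt.eventually ((isOpen_extChartAt_source (γ t)).mem_nhds hx)]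
    with s hs
  exact (transition_apply hs).symm

theorem contDiffAt_extChartAt_comp {γ : ℝ → M} {t : ℝ} (hγ : ContMDiffAt 𝓘(ℝ, ℝ) 𝓘(ℝ, E) ∞ γ t)
    (hy : γ t ∈ (extChartAt 𝓘(ℝ, E) y).source) :
    ContDiffAt ℝ ∞ (fun s => extChartAt 𝓘(ℝ, E) y (γ s)) t :=
  ((contMDiffAt_extChartAt' (extChartAt_source 𝓘(ℝ, E) y ▸ hy)).comp t hγ).contDiffAt

theorem eventually_contMDiffAt_chartLine {t : ℝ} {X : E}
    (h : extChartAt 𝓘(ℝ, E) x x + t • X ∈ (extChartAt 𝓘(ℝ, E) x).target) :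
    ∀ᶠ r in 𝓝 t, ContMDiffAt 𝓘(ℝ, ℝ) 𝓘(ℝ, E) ∞ (chartLine x X) r := by
  have hline : ContDiff ℝ ∞ fun r : ℝ => extChartAt 𝓘(ℝ, E) x x + r • X := by fun_prop
  filter_upwards [hline.continuous.continuousAt.eventually
    ((isOpen_extChartAt_target x).mem_nhds h)] with r hr
  exact ((contMDiffOn_extChartAt_symm x).contMDiffAt
    ((isOpen_extChartAt_target x).mem_nhds hr)).comp r hline.contMDiff.contMDiffAt

theorem eventually_contMDiffAt_chartLine_zero (x : M) (X : E) :
    ∀ᶠ r in 𝓝 0, ContMDiffAt 𝓘(ℝ, ℝ) 𝓘(ℝ, E) ∞ (chartLine x X) r :=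
  eventually_contMDiffAt_chartLine (by
    simpa only [zero_smul, add_zero] using mem_extChartAt_target x)

theorem velocity_chartLine_zero (x : M) (X : E) : velocity (chartLine x X) 0 = X := by
  have hγ := (eventually_contMDiffAt_chartLine_zero x X).self_of_nhds
  have hx : chartLine x X 0 ∈ (extChartAt 𝓘(ℝ, E) x).source := by
    rw [chartLine_zero]
    exact mem_extChartAt_source x
  have h := hasDerivAt_extChartAt_comp (hγ.mdifferentiableAt (by simp)) hx
  rw [chartLine_zero, tangentCoordChange_self (mem_extChartAt_source x)] at h
  have hline : HasDerivAt (fun t : ℝ => extChartAt 𝓘(ℝ, E) x x + t • X) X 0 := by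
    simpa using ((hasDerivAt_id (0 : ℝ)).smul_const X).const_add (extChartAt 𝓘(ℝ, E) x x)
  refine h.unique (hline.congr_of_eventuallyEq ?_)
  filter_upwards [hline.continuousAt.eventually ((isOpen_extChartAt_target x).mem_nhds
    (by simpa only [zero_smul, add_zero] using mem_extChartAt_target x))] with t ht
  exact (extChartAt 𝓘(ℝ, E) x).right_inv ht

end Transition

section ChartMetric

variable {E : Type*} [NormedAddCommGroup E] [NormedSpace ℝ E]
  {M : Type*} [TopologicalSpace M] [ChartedSpace E M] [IsManifold 𝓘(ℝ, E) ∞ M] {p q : ℕ}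
  (g : SemiRiemannianMetric E M p q) {x y z : M}

theorem chartMetric_extChartAt (hz : z ∈ (extChartAt 𝓘(ℝ, E) y).source) (v w : E) :
    chartMetric g y (extChartAt 𝓘(ℝ, E) y z) v w =
      g.form z (tangentCoordChange 𝓘(ℝ, E) y z z v) (tangentCoordChange 𝓘(ℝ, E) y z z w) := by
  simp only [chartMetric, ContinuousLinearMap.bilinearComp_apply,
    (extChartAt 𝓘(ℝ, E) y).left_inv hz]

theorem form_eq_chartMetric (hz : z ∈ (extChartAt 𝓘(ℝ, E) y).source) (v w : E) :
    g.form z v w = chartMetric g y (extChartAt 𝓘(ℝ, E) y z)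
      (tangentCoordChange 𝓘(ℝ, E) z y z v) (tangentCoordChange 𝓘(ℝ, E) z y z w) := by
  rw [chartMetric_extChartAt g hz, tangentCoordChange_tangentCoordChange (mem_extChartAt_source z)
    hz, tangentCoordChange_tangentCoordChange (mem_extChartAt_source z) hz]

theorem chartMetric_self (x : M) : chartMetric g x (extChartAt 𝓘(ℝ, E) x x) = g.form x := by
  ext v w
  rw [chartMetric_extChartAt g (mem_extChartAt_source x),
    tangentCoordChange_self (mem_extChartAt_source x),
    tangentCoordChange_self (mem_extChartAt_source x)]

theorem chartMetric_symm (y : M) (u v w : E) : chartMetric g y u v w = chartMetric g y u w v := by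
  simp only [chartMetric, ContinuousLinearMap.bilinearComp_apply]
  exact g.symm _ _ _

theorem isInvertible_form [FiniteDimensional ℝ E] (x : M) : (g.form x).IsInvertible :=
  isInvertible_of_nondegenerate (form_nondegenerate g x)

theorem chartMetric_eventuallyEq_pullbackForm (hx : z ∈ (extChartAt 𝓘(ℝ, E) x).source)
    (hy : z ∈ (extChartAt 𝓘(ℝ, E) y).source) :
    chartMetric g y =ᶠ[𝓝 (extChartAt 𝓘(ℝ, E) y z)]
      pullbackForm (transition y x) (chartMetric g x) := by
  filter_upwards [eventually_exists_extChartAt_eq hy ((isOpen_extChartAt_source x).mem_nhds hx)]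
  rintro _ ⟨ζ, ⟨hζy, hζx⟩, rfl⟩
  ext v w
  rw [pullbackForm, ContinuousLinearMap.bilinearComp_apply, fderiv_transition,
    transition_apply hζy, chartMetric_extChartAt g hζy, chartMetric_extChartAt g hζx,
    tangentCoordChange_comp ⟨⟨hζy, hζx⟩, mem_extChartAt_source ζ⟩,
    tangentCoordChange_comp ⟨⟨hζy, hζx⟩, mem_extChartAt_source ζ⟩]

variable [FiniteDimensional ℝ E]

theorem isInvertible_chartMetric (hz : z ∈ (extChartAt 𝓘(ℝ, E) y).source) :
    (chartMetric g y (extChartAt 𝓘(ℝ, E) y z)).IsInvertible := by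
  have hz' := mem_extChartAt_source (I := 𝓘(ℝ, E)) z
  rw [(chartMetric_eventuallyEq_pullbackForm g hz' hz).eq_of_nhds]
  refine isInvertible_pullbackForm ?_ ?_
  · rw [fderiv_transition]
    exact isInvertible_tangentCoordChange hz hz'
  · rw [transition_apply hz, chartMetric_self]
    exact isInvertible_form g z

theorem contDiffAt_chartMetric (y : M) {u : E} (hu : u ∈ (extChartAt 𝓘(ℝ, E) y).target) :
    ContDiffAt ℝ ∞ (chartMetric g y) u := by
  have hconst (v : E) : ContMDiffOn 𝓘(ℝ, E) (𝓘(ℝ, E).prod 𝓘(ℝ, E)) ∞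
      (fun m : M => Bundle.TotalSpace.mk' E m
        ((trivializationAt E (TangentSpace 𝓘(ℝ, E)) y).symmL ℝ m v : TangentSpace 𝓘(ℝ, E) m))
      (chartAt E y).source :=
    ((trivializationAt E (TangentSpace 𝓘(ℝ, E) : M → Type _) y).contMDiffOn_symmL (𝕜 := ℝ)
      (IB := 𝓘(ℝ, E)) (n := ∞)).clm_bundle_apply (v := fun _ => v) fun x _ => by
        rw [Bundle.contMDiffWithinAt_section]
        exact contMDiffWithinAt_const
  have hmem {u : E} (hu : u ∈ (extChartAt 𝓘(ℝ, E) y).target) :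
      (extChartAt 𝓘(ℝ, E) y).symm u ∈ (chartAt E y).source :=
    extChartAt_source 𝓘(ℝ, E) y ▸ (extChartAt 𝓘(ℝ, E) y).map_target hu
  refine contDiffAt_clm_of_apply fun v => contDiffAt_clm_of_apply fun w => ?_
  have hgvw := (g.contMDiff.contMDiffOn.clm_bundle_apply₂ (F₁ := E) (F₂ := E) (F₃ := ℝ)
    (E₃ := Bundle.Trivial M ℝ) (hconst v) (hconst w)).contMDiffAt
      ((chartAt E y).open_source.mem_nhds (hmem hu))
  simp only [Bundle.contMDiffAt_section] at hgvw
  refine (hgvw.comp u ((contMDiffOn_extChartAt_symm y).contMDiffAt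
    ((isOpen_extChartAt_target y).mem_nhds hu))).contDiffAt.congr_of_eventuallyEq ?_
  filter_upwards [(isOpen_extChartAt_target y).mem_nhds hu] with u' hu'
  have hcoord (a : E) : tangentCoordChange 𝓘(ℝ, E) y ((extChartAt 𝓘(ℝ, E) y).symm u')
      ((extChartAt 𝓘(ℝ, E) y).symm u') a =
      (trivializationAt E (TangentSpace 𝓘(ℝ, E)) y).symmL ℝ ((extChartAt 𝓘(ℝ, E) y).symm u') a := by
    rw [TangentBundle.symmL_trivializationAt_eq_core (I := 𝓘(ℝ, E)) (hmem hu')]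
    rfl
  simp only [chartMetric, ContinuousLinearMap.bilinearComp_apply, hcoord]
  rfl

theorem isLocalIsometryAt_transition (hx : z ∈ (extChartAt 𝓘(ℝ, E) x).source)
    (hy : z ∈ (extChartAt 𝓘(ℝ, E) y).source) :
    IsLocalIsometryAt (transition y x) (chartMetric g y) (chartMetric g x)
      (extChartAt 𝓘(ℝ, E) y z) where
  contDiffAt_map := (contDiffAt_transition hy hx).of_le (WithTop.coe_le_coe.2 le_top)
  contDiffAt_form := by
    rw [transition_apply hy]
    exact (contDiffAt_chartMetric g x ((extChartAt 𝓘(ℝ, E) x).map_source hx)).of_le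
      (WithTop.coe_le_coe.2 le_top)
  isInvertible_fderiv := fderiv_transition (E := E) y x z ▸ isInvertible_tangentCoordChange hy hx
  isInvertible_form := (transition_apply hy).symm ▸ isInvertible_chartMetric g hx
  symm_form := .of_forall fun _ => chartMetric_symm g x _
  eq_pullbackForm := chartMetric_eventuallyEq_pullbackForm g hx hy

theorem schouten_eq (x : M) :
    g.schouten x = schoutenTensor p q (chartMetric g x) (extChartAt 𝓘(ℝ, E) x x) := by
  unfold SemiRiemannianMetric.schouten schoutenTensor SemiRiemannianMetric.scal scalarCurvature
  rw [chartMetric_self]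
  rfl

end ChartMetric

section Parallel

variable {E : Type*} [NormedAddCommGroup E] [NormedSpace ℝ E]
  {M : Type*} [TopologicalSpace M] [ChartedSpace E M] [IsManifold 𝓘(ℝ, E) ∞ M] {p q : ℕ}
  {g : SemiRiemannianMetric E M p q} {γ : ℝ → M} {t : ℝ} {x y z : M}

/-- The coordinate change of tractors at `z` from the chart at `x` to the chart at `y`. -/
def tractorCoordChange (x y z : M) : Tractor E →L[ℝ] Tractor E :=
  tractorMap (tangentCoordChange 𝓘(ℝ, E) x y z)

theorem tractorCoordChange_self (hz : z ∈ (extChartAt 𝓘(ℝ, E) y).source) (T : Tractor E) :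
    tractorCoordChange y y z T = T := by
  rw [tractorCoordChange, tractorMap_apply, tangentCoordChange_self hz]

theorem tractorCoordChange_comp {w : M} (h : z ∈ (extChartAt 𝓘(ℝ, E) w).source ∩
    (extChartAt 𝓘(ℝ, E) x).source ∩ (extChartAt 𝓘(ℝ, E) y).source) (T : Tractor E) :
    tractorCoordChange x y z (tractorCoordChange w x z T) = tractorCoordChange w y z T := by
  simp only [tractorCoordChange, tractorMap_apply, tangentCoordChange_comp h]

theorem tractorCoordChange_tractorCoordChange (hx : z ∈ (extChartAt 𝓘(ℝ, E) x).source)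
    (hy : z ∈ (extChartAt 𝓘(ℝ, E) y).source) (T : Tractor E) :
    tractorCoordChange y x z (tractorCoordChange x y z T) = T := by
  rw [tractorCoordChange_comp ⟨⟨hx, hy⟩, hx⟩, tractorCoordChange_self hx]

theorem isInvertible_tractorCoordChange (hx : z ∈ (extChartAt 𝓘(ℝ, E) x).source)
    (hy : z ∈ (extChartAt 𝓘(ℝ, E) y).source) :
    (tractorCoordChange (E := E) x y z).IsInvertible :=
  ⟨.equivOfInverse _ (tractorCoordChange y x z) (tractorCoordChange_tractorCoordChange hx hy)
    (tractorCoordChange_tractorCoordChange hy hx), rfl⟩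

/-- The expression, in the coordinates of the preferred chart at `y`, of the endomorphism `A` of the
tractor fibre at `z`. -/
def endCoord (y z : M) (A : Tractor E →L[ℝ] Tractor E) : Tractor E →L[ℝ] Tractor E :=
  (tractorCoordChange z y z).comp (A.comp (tractorCoordChange y z z))

theorem endCoord_self (x : M) (A : Tractor E →L[ℝ] Tractor E) : endCoord x x A = A := by
  refine ContinuousLinearMap.ext fun T => ?_
  simp only [endCoord, ContinuousLinearMap.comp_apply,
    tractorCoordChange_self (mem_extChartAt_source x)]

theorem tractorMetric_eq_tractorForm_chartMetric [FiniteDimensional ℝ E]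
    (hz : z ∈ (extChartAt 𝓘(ℝ, E) y).source) (S T : Tractor E) :
    tractorMetric g z S T = tractorForm (chartMetric g y (extChartAt 𝓘(ℝ, E) y z))
      (tractorCoordChange z y z S) (tractorCoordChange z y z T) := by
  rw [tractorMetric, form_eq_chartMetric g hz]
  rfl

variable [FiniteDimensional ℝ E]

theorem isParallelAt_iff {T : ℝ → Tractor E} : IsParallelAt g γ T t ↔
    HasDerivAt (fun s => tractorCoordChange (γ s) (γ t) (γ s) (T s))
      (-connectionForm p q (chartMetric g (γ t)) (extChartAt 𝓘(ℝ, E) (γ t) (γ t))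
        (velocity γ t) (T t)) t := by
  have hsplit (a b c : E) : -a - b - c = -(a + b + c) := by abel
  have hraise : raise (chartMetric g (γ t) (extChartAt 𝓘(ℝ, E) (γ t) (γ t))) (g.schouten (γ t)) =
      g.schoutenEnd (γ t) := by
    rw [chartMetric_self]
    rfl
  rw [hasDerivAt_tractor_iff, connectionForm_apply (isInvertible_chartMetric g
    (mem_extChartAt_source (γ t))), ← schouten_eq, hraise, chartMetric_self]
  simp only [Prod.fst_neg, Prod.snd_neg, neg_neg, tractorCoordChange, tractorMap_apply]
  refine ⟨fun h => ⟨h.top, hsplit _ _ _ ▸ h.mid, h.bot⟩,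
    fun h => ⟨h.1, ?_, h.2.2⟩⟩
  exact (hsplit _ _ _).symm ▸ h.2.1

theorem isParallelAt_of_hasDerivAt_chart (hγ : MDifferentiableAt 𝓘(ℝ, ℝ) 𝓘(ℝ, E) γ t)
    (hy : γ t ∈ (extChartAt 𝓘(ℝ, E) y).source) {T : ℝ → Tractor E} {X : E}
    (hX : HasDerivAt (fun s => extChartAt 𝓘(ℝ, E) y (γ s)) X t)
    (hT : HasDerivAt T
      (-connectionForm p q (chartMetric g y) (extChartAt 𝓘(ℝ, E) y (γ t)) X (T t)) t) :
    IsParallelAt g γ (fun s => tractorCoordChange y (γ s) (γ s) (T s)) t := by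
  have hx := mem_extChartAt_source (I := 𝓘(ℝ, E)) (γ t)
  have hXv : tangentCoordChange 𝓘(ℝ, E) y (γ t) (γ t) X = velocity γ t := by
    rw [hX.unique (hasDerivAt_extChartAt_comp hγ hy), tangentCoordChange_tangentCoordChange hx hy]
  have key := (isLocalIsometryAt_transition g hx hy).hasDerivAt_tractorMap hX hT
  rw [transition_apply hy, fderiv_transition, hXv] at key
  refine isParallelAt_iff.2 (key.congr_of_eventuallyEq ?_)
  filter_upwards [hγ.continuousAt.eventually (((isOpen_extChartAt_source (I := 𝓘(ℝ, E))
    (γ t)).inter (isOpen_extChartAt_source (I := 𝓘(ℝ, E)) y)).mem_nhds ⟨hx, hy⟩)] with s hs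
  rw [tractorCoordChange_comp ⟨⟨hs.2, mem_extChartAt_source (γ s)⟩, hs.1⟩, fderiv_transition]
  rfl

theorem hasDerivAt_tractorMetric (hγ : MDifferentiableAt 𝓘(ℝ, ℝ) 𝓘(ℝ, E) γ t)
    {S T : ℝ → Tractor E} (hS : IsParallelAt g γ S t) (hT : IsParallelAt g γ T t) :
    HasDerivAt (fun s => tractorMetric g (γ s) (S s) (T s)) 0 t := by
  have hx := mem_extChartAt_source (I := 𝓘(ℝ, E)) (γ t)
  have hu := hasDerivAt_extChartAt_comp hγ hx
  rw [tangentCoordChange_self hx] at hu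
  rw [isParallelAt_iff, ← tractorCoordChange_self hx (S t)] at hS
  rw [isParallelAt_iff, ← tractorCoordChange_self hx (T t)] at hT
  refine (hasDerivAt_tractorForm_of_parallel ((contDiffAt_chartMetric g (γ t)
    (mem_extChartAt_target (γ t))).differentiableAt (by simp)) (isInvertible_chartMetric g hx)
    (.of_forall fun _ => chartMetric_symm g (γ t) _) hu hS hT).congr_of_eventuallyEq ?_
  filter_upwards [hγ.continuousAt.eventually ((isOpen_extChartAt_source (γ t)).mem_nhds hx)]
    with s hs
  exact tractorMetric_eq_tractorForm_chartMetric hs _ _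

theorem IsSmoothTransport.tractorMetric_eq {P : Tractor E ≃L[ℝ] Tractor E}
    (h : IsSmoothTransport g γ P) (S T : Tractor E) :
    tractorMetric g (γ 1) (P S) (P T) = tractorMetric g (γ 0) S T := by
  obtain ⟨hγ, h⟩ := h
  obtain ⟨S', hS, rfl, hS₁⟩ := h S
  obtain ⟨T', hT, rfl, hT₁⟩ := h T
  have hconst (t : ℝ) : HasDerivAt (fun s => tractorMetric g (γ s) (S' s) (T' s)) 0 t :=
    hasDerivAt_tractorMetric ((hγ t).mdifferentiableAt (by simp)) (hS t) (hT t)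
  rw [← hS₁, ← hT₁]
  exact is_const_of_deriv_eq_zero (fun t => (hconst t).differentiableAt)
    (fun t => (hconst t).deriv) 1 0

theorem IsTransport.tractorMetric_eq {P : Tractor E ≃L[ℝ] Tractor E} (h : IsTransport g y z P)
    (S T : Tractor E) : tractorMetric g z (P S) (P T) = tractorMetric g y S T := by
  induction h with
  | refl => rfl
  | snoc γ _ hQ ih => rw [← ih]; exact hQ.tractorMetric_eq _ _

end Parallel

/-! ### Existence of parallel transport -/

theorem exists_eventually_hasDerivAt {F : Type*} [NormedAddCommGroup F] [NormedSpace ℝ F]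
    [CompleteSpace F] {v : ℝ → F → F} {t₀ : ℝ} {z₀ : F}
    (hv : ContDiffAt ℝ 1 (uncurry v) (t₀, z₀)) :
    ∃ z : ℝ → F, z t₀ = z₀ ∧ ∀ᶠ t in 𝓝 t₀, HasDerivAt z (v t (z t)) t := by
  -- The equation becomes autonomous once time is added to the unknowns.
  obtain ⟨ζ, hζ₀, ε, hε, hζ⟩ := (ContDiffAt.prodMk contDiffAt_const hv :
    ContDiffAt ℝ 1 (fun x : ℝ × F => ((1 : ℝ), uncurry v x)) _)
      |>.exists_forall_mem_closedBall_exists_eq_forall_mem_Ioo_hasDerivAt₀ t₀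
  have htime : ∀ t ∈ Ioo (t₀ - ε) (t₀ + ε), (ζ t).1 = t := by
    have hmem : t₀ ∈ Ioo (t₀ - ε) (t₀ + ε) := by simp [hε]
    have hd (t) (ht : t ∈ Ioo (t₀ - ε) (t₀ + ε)) : HasDerivAt (fun s => (ζ s).1 - s) 0 t := by
      have h : HasDerivAt (fun s => (ζ s).1) 1 t := (hζ t ht).fst
      exact (h.sub (hasDerivAt_id' t)).congr_deriv (sub_self 1)
    intro t ht
    have h := isOpen_Ioo.is_const_of_deriv_eq_zero isPreconnected_Ioo
      (fun s hs => (hd s hs).differentiableAt.differentiableWithinAt) (fun s hs => (hd s hs).deriv)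
      ht hmem
    simpa [hζ₀, sub_eq_zero] using h
  refine ⟨fun t => (ζ t).2, congrArg Prod.snd hζ₀, ?_⟩
  filter_upwards [Ioo_mem_nhds (sub_lt_self t₀ hε) (lt_add_of_pos_right t₀ hε)] with t ht
  have h := (hζ t ht).snd
  rwa [uncurry, htime t ht] at h

theorem exists_fundamental_solution {F : Type*} [NormedAddCommGroup F] [NormedSpace ℝ F]
    [CompleteSpace F] {A : ℝ → F →L[ℝ] F} {t₀ : ℝ} (hA : ContDiffAt ℝ 1 A t₀) :
    ∃ Φ : ℝ → F →L[ℝ] F, Φ t₀ = .id ℝ F ∧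
      ∀ᶠ t in 𝓝 t₀, (Φ t).IsInvertible ∧ HasDerivAt Φ ((A t).comp (Φ t)) t := by
  obtain ⟨Φ, hΦ₀, hΦ⟩ := exists_eventually_hasDerivAt (v := fun t Φ => (A t).comp Φ)
    (z₀ := .id ℝ F) ((hA.comp (t₀, _) contDiffAt_fst).clm_comp contDiffAt_snd)
  exact ⟨Φ, hΦ₀, (eventually_isInvertible hΦ.self_of_nhds.continuousAt
    (hΦ₀ ▸ ⟨.refl ℝ F, rfl⟩)).and hΦ⟩

section Transport

variable {E : Type*} [NormedAddCommGroup E] [NormedSpace ℝ E] [FiniteDimensional ℝ E]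
  {M : Type*} [TopologicalSpace M] [ChartedSpace E M] [IsManifold 𝓘(ℝ, E) ∞ M] {p q : ℕ}
  {g : SemiRiemannianMetric E M p q} {γ : ℝ → M} {x y z : M} {t t₀ t₁ : ℝ}

theorem IsSmoothTransport.isTransport {P : Tractor E ≃L[ℝ] Tractor E}
    (h : IsSmoothTransport g γ P) : IsTransport g (γ 0) (γ 1) P :=
  .snoc γ (.refl _) h

/-- The connection form of the normal tractor connection along the curve `γ`, in the preferred
chart at `y`: a tractor along `γ` with coordinate expression `T` is parallel when
`T' = -curveConnection g y γ t T`. -/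
def curveConnection (g : SemiRiemannianMetric E M p q) (y : M) (γ : ℝ → M) (t : ℝ) :
    Tractor E →L[ℝ] Tractor E :=
  connectionForm p q (chartMetric g y) (extChartAt 𝓘(ℝ, E) y (γ t))
    (deriv (fun s => extChartAt 𝓘(ℝ, E) y (γ s)) t)

theorem contDiffAt_curveConnection (hγ : ContMDiffAt 𝓘(ℝ, ℝ) 𝓘(ℝ, E) ∞ γ t)
    (hy : γ t ∈ (extChartAt 𝓘(ℝ, E) y).source) : ContDiffAt ℝ 1 (curveConnection g y γ) t := by
  have hu := contDiffAt_extChartAt_comp hγ hy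
  have hG := (contDiffAt_chartMetric g y ((extChartAt 𝓘(ℝ, E) y).map_source hy)).of_le
    (WithTop.coe_le_coe.2 le_top : (1 + 2 : WithTop ℕ∞) ≤ ∞)
  exact ((contDiffAt_connectionForm p q (isInvertible_chartMetric g hy) hG).comp t
    (hu.of_le (WithTop.coe_le_coe.2 le_top))).clm_apply
      ((hu.fderiv_right (WithTop.coe_le_coe.2 le_top)).clm_apply contDiffAt_const)

theorem isTransport_of_hasDerivAt {Φ : ℝ → Tractor E →L[ℝ] Tractor E} (hΦ₀ : Φ t₀ = .id ℝ _)
    (h : ∀ t ∈ uIcc t₀ t₁, ContMDiffAt 𝓘(ℝ, ℝ) 𝓘(ℝ, E) ∞ γ t ∧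
      γ t ∈ (extChartAt 𝓘(ℝ, E) (γ t₀)).source ∧
      HasDerivAt Φ ((-curveConnection g (γ t₀) γ t).comp (Φ t)) t)
    {P : Tractor E ≃L[ℝ] Tractor E}
    (hP : ∀ T, P T = tractorCoordChange (γ t₀) (γ t₁) (γ t₁) (Φ t₁ T)) :
    IsTransport g (γ t₀) (γ t₁) P := by
  -- Transports are defined by curves on all of `ℝ`, hence the reparametrisation.
  let τ (s : ℝ) : ℝ := AffineMap.lineMap t₀ t₁ (Real.smoothTransition s)
  have hτ : ContDiff ℝ ∞ τ := by
    simp only [τ, AffineMap.lineMap_apply_module]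
    have := Real.smoothTransition.contDiff (n := ⊤)
    fun_prop
  have hτ_mem (s : ℝ) : τ s ∈ uIcc t₀ t₁ := segment_eq_uIcc t₀ t₁ ▸
    lineMap_mem_segment ℝ t₀ t₁ ⟨Real.smoothTransition.nonneg s, Real.smoothTransition.le_one s⟩
  have hτ₀ : τ 0 = t₀ := by simp [τ]
  have hτ₁ : τ 1 = t₁ := by simp [τ]
  have hγτ (s : ℝ) : ContMDiffAt 𝓘(ℝ, ℝ) 𝓘(ℝ, E) ∞ (γ ∘ τ) s :=
    (h _ (hτ_mem s)).1.comp s hτ.contMDiff.contMDiffAt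
  suffices IsSmoothTransport g (γ ∘ τ) P by simpa only [comp_apply, hτ₀, hτ₁] using this.isTransport
  refine ⟨hγτ, fun v => ⟨fun s => tractorCoordChange (γ t₀) (γ (τ s)) (γ (τ s)) (Φ (τ s) v),
    fun s => ?_, ?_, ?_⟩⟩
  · obtain ⟨hγ, hs, hΦ⟩ := h _ (hτ_mem s)
    have hτs := (hτ.differentiable (by simp) s).hasDerivAt
    refine isParallelAt_of_hasDerivAt_chart ((hγτ s).mdifferentiableAt (by simp)) hs
      ((((contDiffAt_extChartAt_comp hγ hs).differentiableAt (by simp)).hasDerivAt).scomp s hτs)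
      (((hΦ.scomp s hτs).clm_apply (hasDerivAt_const s v)).congr_deriv ?_)
    simp [curveConnection]
  · simp only [hτ₀, hΦ₀, tractorCoordChange_self (mem_extChartAt_source _),
      ContinuousLinearMap.id_apply]
  · simp only [hτ₁, hP]

theorem exists_parallelFrame (g : SemiRiemannianMetric E M p q)
    (hγ : ∀ᶠ t in 𝓝 t₀, ContMDiffAt 𝓘(ℝ, ℝ) 𝓘(ℝ, E) ∞ γ t) :
    ∃ Φ : ℝ → Tractor E →L[ℝ] Tractor E, Φ t₀ = .id ℝ _ ∧
      HasDerivAt Φ (-curveConnection g (γ t₀) γ t₀) t₀ ∧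
      ∀ᶠ t in 𝓝 t₀, (Φ t).IsInvertible ∧ ∃ P, IsTransport g (γ t₀) (γ t) P ∧
        ∀ T, P T = tractorCoordChange (γ t₀) (γ t) (γ t) (Φ t T) := by
  have hγ₀ := hγ.self_of_nhds
  have hsrc := hγ₀.continuousAt.eventually (extChartAt_source_mem_nhds (I := 𝓘(ℝ, E)) (γ t₀))
  obtain ⟨Φ, hΦ₀, hΦ⟩ := exists_fundamental_solution
    (contDiffAt_curveConnection (g := g) hγ₀ (mem_extChartAt_source (γ t₀))).neg
  refine ⟨Φ, hΦ₀, by simpa [hΦ₀] using hΦ.self_of_nhds.2, ?_⟩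
  obtain ⟨ε, hε, h⟩ := Metric.eventually_nhds_iff_ball.1 ((hγ.and hsrc).and hΦ)
  filter_upwards [Metric.ball_mem_nhds t₀ hε] with t ht
  obtain ⟨⟨-, hs⟩, hinv, -⟩ := h t ht
  obtain ⟨P, hP⟩ := (isInvertible_tractorCoordChange hs (mem_extChartAt_source (γ t))).comp hinv
  have hP (T : Tractor E) : P T = tractorCoordChange (γ t₀) (γ t) (γ t) (Φ t T) :=
    congrArg (· T) hP
  refine ⟨hinv, P, isTransport_of_hasDerivAt hΦ₀ (fun s hs => ?_) hP, hP⟩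
  have hs := h s ((convex_ball t₀ ε).ordConnected.uIcc_subset (Metric.mem_ball_self hε) ht hs)
  exact ⟨hs.1.1, hs.1.2, hs.2.2⟩

theorem curveConnection_self (hγ : MDifferentiableAt 𝓘(ℝ, ℝ) 𝓘(ℝ, E) γ t) :
    curveConnection g (γ t) γ t = connectionForm p q (chartMetric g (γ t))
      (extChartAt 𝓘(ℝ, E) (γ t) (γ t)) (velocity γ t) := by
  rw [curveConnection, (hasDerivAt_extChartAt_comp hγ (mem_extChartAt_source (γ t))).deriv,
    tangentCoordChange_self (mem_extChartAt_source (γ t))]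

theorem exists_isTransport_of_isPreconnected (g : SemiRiemannianMetric E M p q) {s : Set ℝ}
    (hs : IsPreconnected s)
    (hγ : ∀ t ∈ s, ∀ᶠ r in 𝓝 t, ContMDiffAt 𝓘(ℝ, ℝ) 𝓘(ℝ, E) ∞ γ r) (h₀ : t₀ ∈ s) (h₁ : t₁ ∈ s) :
    ∃ P, IsTransport g (γ t₀) (γ t₁) P := by
  refine hs.induction₂ (fun t t' => ∃ P, IsTransport g (γ t) (γ t') P) (fun t ht => ?_)
    (fun _ _ _ _ _ _ ⟨P, hP⟩ ⟨Q, hQ⟩ => ⟨_, hP.trans hQ⟩) (fun _ _ _ _ ⟨P, hP⟩ => ⟨_, hP.symm⟩)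
    h₀ h₁
  obtain ⟨Φ, -, -, hΦ⟩ := exists_parallelFrame g (hγ t ht)
  exact nhdsWithin_le_nhds (hΦ.mono fun r ⟨_, P, hP, _⟩ => ⟨P, hP⟩)

theorem eventually_exists_isTransport (g : SemiRiemannianMetric E M p q) (x : M) :
    ∀ᶠ y in 𝓝 x, ∃ P, IsTransport g x y P := by
  let a := extChartAt 𝓘(ℝ, E) x x
  obtain ⟨ε, hε, hball⟩ := Metric.mem_nhds_iff.1 (extChartAt_target_mem_nhds (I := 𝓘(ℝ, E)) x)
  filter_upwards [extChartAt_source_mem_nhds (I := 𝓘(ℝ, E)) x,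
    (continuousAt_extChartAt (I := 𝓘(ℝ, E)) x).eventually (Metric.ball_mem_nhds a hε)] with y hy hya
  let line : ℝ →ᵃ[ℝ] E := AffineMap.lineMap a (extChartAt 𝓘(ℝ, E) x y)
  have hline (t : ℝ) : a + t • (extChartAt 𝓘(ℝ, E) x y - a) = line t := by
    simp [line, AffineMap.lineMap_apply, add_comm]
  obtain ⟨P, hP⟩ := exists_isTransport_of_isPreconnected g
    (γ := chartLine x (extChartAt 𝓘(ℝ, E) x y - a)) (t₀ := 0) (t₁ := 1)
    ((convex_ball a ε).affine_preimage line).isPreconnected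
    (fun t ht => eventually_contMDiffAt_chartLine (hball (hline t ▸ ht)))
    (by simp [line, hε]) (by simpa [line] using hya)
  rw [chartLine_zero, chartLine, one_smul, add_sub_cancel,
    (extChartAt 𝓘(ℝ, E) x).left_inv hy] at hP
  exact ⟨P, hP⟩

theorem exists_isTransport [PreconnectedSpace M] (g : SemiRiemannianMetric E M p q) (x y : M) :
    ∃ P, IsTransport g x y P := by
  refine isPreconnected_univ.induction₂ (fun x y => ∃ P, IsTransport g x y P) (fun x _ => ?_)
    (fun _ _ _ _ _ _ ⟨P, hP⟩ ⟨Q, hQ⟩ => ⟨_, hP.trans hQ⟩) (fun _ _ _ _ ⟨P, hP⟩ => ⟨_, hP.symm⟩)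
    (mem_univ x) (mem_univ y)
  exact nhdsWithin_le_nhds (eventually_exists_isTransport g x)

end Transport

/-! ### The holonomy algebra -/

theorem mem_of_hasDerivAt {F : Type*} [NormedAddCommGroup F] [NormedSpace ℝ F]
    {W : Submodule ℝ F} [FiniteDimensional ℝ W] {f : ℝ → F} {f' : F} {t₀ : ℝ}
    (hf : HasDerivAt f f' t₀) (hW : ∀ᶠ t in 𝓝 t₀, f t ∈ W) : f' ∈ W := by
  refine W.closed_of_finiteDimensional.mem_of_tendsto hf.tendsto_slope ?_
  filter_upwards [hW.filter_mono nhdsWithin_le_nhds] with t ht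
  exact W.smul_mem _ (W.sub_mem ht hW.self_of_nhds)

section LieAlgebra

variable {V W : Type*} [NormedAddCommGroup V] [NormedSpace ℝ V] [NormedAddCommGroup W]
  [NormedSpace ℝ W] {H : Subgroup (V ≃L[ℝ] V)} {A B : V →L[ℝ] V}

theorem hasDerivAt_inverse [CompleteSpace V] {c : ℝ → V →L[ℝ] V} {t₀ : ℝ}
    (hc : HasDerivAt c A t₀) (hc₀ : c t₀ = .id ℝ V) :
    HasDerivAt (fun t => (c t).inverse) (-A) t₀ := by
  have hinv := hasFDerivAt_ringInverse (𝕜 := ℝ) (1 : (V →L[ℝ] V)ˣ)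
  rw [Units.val_one, show (1 : V →L[ℝ] V) = c t₀ from hc₀.symm] at hinv
  rw [← ContinuousLinearMap.ringInverse_eq_inverse]
  refine (hinv.comp_hasDerivAt t₀ hc).congr_deriv ?_
  ext v
  simp

theorem conj_mem_lieAlgebra {K : Subgroup (W ≃L[ℝ] W)} {P : V ≃L[ℝ] W}
    (hP : ∀ Q ∈ H, (P.symm.trans Q).trans P ∈ K) (hA : A ∈ lieAlgebra H) :
    (P : V →L[ℝ] W).comp (A.comp (P.symm : W →L[ℝ] V)) ∈ lieAlgebra K := by
  obtain ⟨c, hc, hcH, hc₀, hcA⟩ := hA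
  refine ⟨fun t => (P : V →L[ℝ] W).comp ((c t).comp (P.symm : W →L[ℝ] V)),
    contDiff_const.clm_comp (hc.clm_comp contDiff_const), fun t => ?_, ?_, ?_⟩
  · obtain ⟨Q, hQ, hQc⟩ := hcH t
    exact ⟨_, hP Q hQ, by simp only [← hQc]; rfl⟩
  · ext w
    simp [hc₀]
  · simpa using (hasDerivAt_const (0 : ℝ) (P : V →L[ℝ] W)).clm_comp
      (hcA.clm_comp (hasDerivAt_const (0 : ℝ) (P.symm : W →L[ℝ] V)))

theorem lie_mem_lieAlgebra [FiniteDimensional ℝ V] (hA : A ∈ lieAlgebra H)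
    (hB : B ∈ lieAlgebra H) : ⁅A, B⁆ ∈ lieAlgebra H := by
  obtain ⟨c, -, hcH, hc₀, hcA⟩ := hA
  have hconj : HasDerivAt (fun t => (c t).comp (B.comp (c t).inverse)) ⁅A, B⁆ 0 := by
    refine (hcA.clm_comp ((hasDerivAt_const (0 : ℝ) B).clm_comp
      (hasDerivAt_inverse hcA hc₀))).congr_deriv ?_
    ext v
    simp [hc₀, Ring.lie_def, sub_eq_add_neg]
  refine mem_of_hasDerivAt hconj (.of_forall fun t => ?_)
  obtain ⟨P, hP, hPc⟩ := hcH t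
  rw [← hPc, ContinuousLinearMap.inverse_equiv]
  exact conj_mem_lieAlgebra (fun Q hQ => H.mul_mem hP (H.mul_mem hQ (H.inv_mem hP))) hB

/-- The Lie algebra of `H`, as a Lie subalgebra of the endomorphisms with their commutator. -/
def lieSubalgebra [FiniteDimensional ℝ V] (H : Subgroup (V ≃L[ℝ] V)) :
    LieSubalgebra ℝ (V →L[ℝ] V) :=
  { lieAlgebra H with lie_mem' := lie_mem_lieAlgebra }

theorem isSkewFor_of_mem_lieAlgebra {β : V →L[ℝ] V →L[ℝ] ℝ}
    (hH : ∀ P ∈ H, ∀ v w, β (P v) (P w) = β v w) (hA : A ∈ lieAlgebra H) : IsSkewFor β A := by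
  obtain ⟨c, -, hcH, hc₀, hcA⟩ := hA
  intro v w
  have hc (v : V) : HasDerivAt (fun t => c t v) (A v) 0 := by
    simpa using hcA.clm_apply (hasDerivAt_const (0 : ℝ) v)
  have hconst : (fun t => β (c t v) (c t w)) = fun _ => β v w := by
    funext t
    obtain ⟨P, hP, hPc⟩ := hcH t
    rw [← hPc]
    exact hH P hP v w
  have hβ := ((hasDerivAt_const (0 : ℝ) β).clm_apply (hc v)).clm_apply (hc w)
  rw [hconst] at hβ
  simpa [hc₀] using hβ.unique (hasDerivAt_const _ _)

end LieAlgebra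

section Holonomy

variable {E : Type*} [NormedAddCommGroup E] [NormedSpace ℝ E] [FiniteDimensional ℝ E]
  {M : Type*} [TopologicalSpace M] [ChartedSpace E M] [IsManifold 𝓘(ℝ, E) ∞ M] {p q : ℕ}
  {g : SemiRiemannianMetric E M p q} {x y z : M} {A : Tractor E →L[ℝ] Tractor E}

theorem IsTransport.conj_mem_holonomyAlgebra {P : Tractor E ≃L[ℝ] Tractor E}
    (hP : IsTransport g x y P) (hA : A ∈ holonomyAlgebra g x) :
    (P : Tractor E →L[ℝ] Tractor E).comp (A.comp (P.symm : Tractor E →L[ℝ] Tractor E)) ∈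
      holonomyAlgebra g y :=
  conj_mem_lieAlgebra (fun _ hQ => (hP.symm.trans hQ).trans hP) hA

theorem isSkewFor_of_mem_holonomyAlgebra (hA : A ∈ holonomyAlgebra g x) :
    IsSkewFor (tractorForm (g.form x)) A :=
  isSkewFor_of_mem_lieAlgebra (fun _ hP => IsTransport.tractorMetric_eq hP) hA

theorem isGenericAt_iff : IsGenericAt g x ↔
    ∀ A, IsSkewFor (tractorForm (g.form x)) A → A ∈ holonomyAlgebra g x :=
  ⟨fun h A hA => (h A).2 hA, fun h A => ⟨isSkewFor_of_mem_holonomyAlgebra, h A⟩⟩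

theorem IsGenericAt.of_isTransport {P : Tractor E ≃L[ℝ] Tractor E} (hx : IsGenericAt g x)
    (hP : IsTransport g x y P) : IsGenericAt g y := by
  refine isGenericAt_iff.2 fun A hA => ?_
  have hconj := hP.conj_mem_holonomyAlgebra ((hx ((P.symm : Tractor E →L[ℝ] Tractor E).comp
    (A.comp (P : Tractor E →L[ℝ] Tractor E)))).2 fun S T => ?_)
  · convert hconj using 1
    exact ContinuousLinearMap.ext fun T => by simp
  · simp only [ContinuousLinearMap.comp_apply, ContinuousLinearEquiv.coe_coe]
    rw [← hP.tractorMetric_eq, ← hP.tractorMetric_eq, P.apply_symm_apply, P.apply_symm_apply]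
    exact hA _ _

/-- The holonomy algebra is parallel, hence contains the covariant derivatives of its sections. -/
theorem covariantDeriv_mem_holonomyAlgebra {γ : ℝ → M} {t₀ : ℝ}
    (hγ : ∀ᶠ t in 𝓝 t₀, ContMDiffAt 𝓘(ℝ, ℝ) 𝓘(ℝ, E) ∞ γ t)
    {A : ℝ → Tractor E →L[ℝ] Tractor E} {A' : Tractor E →L[ℝ] Tractor E}
    (hA : ∀ᶠ t in 𝓝 t₀, A t ∈ holonomyAlgebra g (γ t))
    (hA' : HasDerivAt (fun t => endCoord (γ t₀) (γ t) (A t)) A' t₀) :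
    A' + ⁅curveConnection g (γ t₀) γ t₀, A t₀⁆ ∈ holonomyAlgebra g (γ t₀) := by
  obtain ⟨Φ, hΦ₀, hΦ', hΦ⟩ := exists_parallelFrame g hγ
  have hconj : HasDerivAt (fun t => (Φ t).inverse.comp ((endCoord (γ t₀) (γ t) (A t)).comp (Φ t)))
      (A' + ⁅curveConnection g (γ t₀) γ t₀, A t₀⁆) t₀ := by
    refine ((hasDerivAt_inverse hΦ' hΦ₀).clm_comp (hA'.clm_comp hΦ')).congr_deriv ?_
    refine ContinuousLinearMap.ext fun T => ?_
    simp only [endCoord_self, hΦ₀, neg_neg, ContinuousLinearMap.comp_neg,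
      ContinuousLinearMap.comp_id, ContinuousLinearMap.inverse_id, ContinuousLinearMap.id_comp,
      Ring.lie_def, add_apply, neg_apply, sub_apply, mul_apply_eq_comp,
      ContinuousLinearMap.comp_apply]
    abel
  refine mem_of_hasDerivAt (W := holonomyAlgebra g (γ t₀)) hconj ?_
  filter_upwards [hA, hΦ, hγ.self_of_nhds.continuousAt.eventually
    (extChartAt_source_mem_nhds (I := 𝓘(ℝ, E)) (γ t₀))] with t hAt ⟨⟨Ψ, hΨ⟩, P, hP, hPΦ⟩ ht
  have hPΨ (T : Tractor E) : P T = tractorCoordChange (γ t₀) (γ t) (γ t) (Ψ T) := by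
    rw [hPΦ, ← hΨ]
    rfl
  convert hP.symm.conj_mem_holonomyAlgebra hAt using 1
  refine ContinuousLinearMap.ext fun T => P.injective ?_
  rw [← hΨ, ContinuousLinearMap.inverse_equiv]
  simp only [ContinuousLinearMap.comp_apply, ContinuousLinearEquiv.coe_coe,
    ContinuousLinearEquiv.symm_symm, P.apply_symm_apply, hPΨ, endCoord, Ψ.apply_symm_apply]
  rw [tractorCoordChange_tractorCoordChange (mem_extChartAt_source _) ht]

end Holonomy

/-! ### The holonomy distribution -/

section Curves

variable {E : Type*} [NormedAddCommGroup E] [NormedSpace ℝ E]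

/-- The hypothesis says that `B` is parallel if `Γ` is a connection form and `B'` the derivative
of `B`. The difference of raising operators is the derivative of `raisingOp B v` in `B`. -/
theorem raisingOp_add_lie_middleOp {B B' : E →L[ℝ] E →L[ℝ] ℝ} {Γ : E →L[ℝ] E}
    (h : ∀ v w, B' v w = B (Γ v) w + B v (Γ w)) (v : E) :
    raisingOp B' v - raisingOp 0 v + ⁅middleOp Γ, raisingOp B v⁆ = raisingOp B (Γ v) := by
  refine ContinuousLinearMap.ext fun T => ?_
  simp only [Ring.lie_def, add_apply, sub_apply, mul_apply_eq_comp, raisingOp_apply,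
    middleOp_apply, h, map_smul, zero_apply]
  ext <;> simp

theorem hasDerivAt_raisingOp [FiniteDimensional ℝ E] {B : ℝ → E →L[ℝ] E →L[ℝ] ℝ}
    {B' : E →L[ℝ] E →L[ℝ] ℝ} {V : ℝ → E} {V' : E} {t : ℝ} (hB : HasDerivAt B B' t)
    (hV : HasDerivAt V V' t) : HasDerivAt (fun s => raisingOp (B s) (V s))
      (raisingOp B' (V t) - raisingOp 0 (V t) + raisingOp (B t) V') t := by
  refine hasDerivAt_clm_of_apply fun T => hasDerivAt_tractor_iff.2 ⟨?_, ?_, ?_⟩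
  · refine ((hB.clm_apply hV).clm_apply (hasDerivAt_const t T.2.1)).neg.congr_deriv ?_
    simp [raisingOp_apply, add_comm]
  · exact (hV.const_smul T.2.2).congr_deriv (by simp [raisingOp_apply])
  · simpa [raisingOp_apply] using hasDerivAt_const t (0 : ℝ)

end Curves

section Membership

variable {E : Type*} [NormedAddCommGroup E] [NormedSpace ℝ E]
  {M : Type*} [TopologicalSpace M] [ChartedSpace E M] [IsManifold 𝓘(ℝ, E) ∞ M] {p q : ℕ}

theorem form_symm (g : SemiRiemannianMetric E M p q) (x : M) (v w : E) :
    g.form x v w = g.form x w v :=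
  g.symm x v w

theorem finrank_eq (g : SemiRiemannianMetric E M p q) (x : M) : Module.finrank ℝ E = p + q := by
  obtain ⟨e, -⟩ := g.signature x
  change Module.Basis (Fin p ⊕ Fin q) ℝ E at e
  simp [Module.finrank_eq_card_basis e]

theorem exists_form_self_ne_zero (g : SemiRiemannianMetric E M p q) (x : M) (hpq : 0 < p + q) :
    ∃ X, g.form x X X ≠ 0 := by
  obtain ⟨e, he, -⟩ := g.signature x
  have : Nonempty (Fin p ⊕ Fin q) := Fintype.card_pos_iff.1 (by simpa using hpq)
  refine this.elim fun i => ⟨e i, (he i).trans_ne ?_⟩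
  cases i <;> simp

variable [FiniteDimensional ℝ E] {g : SemiRiemannianMetric E M p q} {x : M}

theorem mem_holonomyDistribution_iff {v : E} :
    v ∈ holonomyDistribution g x ↔ raisingOp (g.form x) v ∈ holonomyAlgebra g x := by
  have hline := Submodule.mem_span_singleton_self (R := ℝ) ((1 : ℝ), (0 : E), (0 : ℝ))
  constructor
  · rintro ⟨A, hA, hA', T, rfl⟩
    have hA₀ : A (1, 0, 0) = 0 := hA'.1 _ hline
    have hmid : (midProj E).comp (A.comp (midIncl E)) = 0 :=
      ContinuousLinearMap.ext fun Y => (hA'.apply_mid (0, Y, 0)).trans (zero_smul ℝ _)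
    have hAraise := (isSkewFor_of_mem_holonomyAlgebra hA).eq_add (form_symm g x)
    simp only [hA₀, hmid, Prod.fst_zero, Prod.snd_zero, map_zero, zero_smul, add_zero] at hAraise
    rw [hA'.apply_mid T, map_smul, ← hAraise]
    exact Submodule.smul_mem _ _ hA
  · refine fun h => ⟨_, h, ⟨fun S hS => ?_, fun S T hS hT => ?_⟩, (0, 0, 1), one_smul ℝ v⟩
    · obtain ⟨r, rfl⟩ := Submodule.mem_span_singleton.1 hS
      simp [raisingOp_apply]
    · have hS' : S.2.2 = 0 := by simpa [tractorMetric] using hS _ hline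
      have hT' : T.2.2 = 0 := by simpa [tractorMetric] using hT _ hline
      simp [tractorMetric, raisingOp_apply, hS', hT']

theorem raisingOp_mem_holonomyAlgebra (htop : holonomyDistribution g x = ⊤) (v : E) :
    raisingOp (g.form x) v ∈ holonomyAlgebra g x :=
  mem_holonomyDistribution_iff.1 (htop ▸ Submodule.mem_top)

theorem IsGenericAt.holonomyDistribution_eq_top (h : IsGenericAt g x) :
    holonomyDistribution g x = ⊤ :=
  Submodule.eq_top_iff'.2 fun v => mem_holonomyDistribution_iff.2
    (isGenericAt_iff.1 h _ (isSkewFor_raisingOp (form_symm g x) v))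

theorem holonomyRank_eq_iff : holonomyRank g x = p + q ↔ holonomyDistribution g x = ⊤ := by
  rw [← finrank_eq g x]
  exact ⟨Submodule.eq_top_of_finrank_eq, fun h => by rw [holonomyRank, h, finrank_top]⟩

end Membership

section CovariantDerivative

variable {E : Type*} [NormedAddCommGroup E] [NormedSpace ℝ E]
  {M : Type*} [TopologicalSpace M] [ChartedSpace E M] [IsManifold 𝓘(ℝ, E) ∞ M] {p q : ℕ}

theorem endCoord_raisingOp (g : SemiRiemannianMetric E M p q) {y z : M}
    (hz : z ∈ (extChartAt 𝓘(ℝ, E) y).source) (v : E) :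
    endCoord y z (raisingOp (g.form z) v) =
      raisingOp (chartMetric g y (extChartAt 𝓘(ℝ, E) y z))
        (tangentCoordChange 𝓘(ℝ, E) z y z v) := by
  refine ContinuousLinearMap.ext fun T => ?_
  simp only [endCoord, tractorCoordChange, ContinuousLinearMap.comp_apply, tractorMap_apply,
    raisingOp_apply, map_smul, form_eq_chartMetric g hz,
    tangentCoordChange_tangentCoordChange hz (mem_extChartAt_source z)]

theorem endCoord_gradingOp (y z : M) : endCoord y z (gradingOp E) = gradingOp E := by
  refine ContinuousLinearMap.ext fun T => ?_
  simp only [endCoord, tractorCoordChange, ContinuousLinearMap.comp_apply, tractorMap_apply,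
    gradingOp_apply, map_zero]

variable [FiniteDimensional ℝ E] {g : SemiRiemannianMetric E M p q} {γ : ℝ → M} {t₀ : ℝ}

/-- The covariant derivative of `s₋ ∧ V` is `s₋ ∧ ∇V` plus the bracket of `γ̇ ∧ s₊` with
`s₋ ∧ V`, since `s₋ ∧ P(γ̇)` commutes with `s₋ ∧ V`. -/
theorem covariantDeriv_raisingOp_mem_holonomyAlgebra
    (hγ : ∀ᶠ t in 𝓝 t₀, ContMDiffAt 𝓘(ℝ, ℝ) 𝓘(ℝ, E) ∞ γ t) {V : ℝ → E} {V' : E}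
    (hV : ∀ᶠ t in 𝓝 t₀, V t ∈ holonomyDistribution g (γ t))
    (hV' : HasDerivAt (fun t => tangentCoordChange 𝓘(ℝ, E) (γ t) (γ t₀) (γ t) (V t)) V' t₀) :
    raisingOp (g.form (γ t₀)) (V' + christoffel (chartMetric g (γ t₀))
        (extChartAt 𝓘(ℝ, E) (γ t₀) (γ t₀)) (velocity γ t₀) (V t₀)) -
      (middleOp (rotation (g.form (γ t₀)) (velocity γ t₀) (V t₀)) -
        g.form (γ t₀) (velocity γ t₀) (V t₀) • gradingOp E) ∈ holonomyAlgebra g (γ t₀) := by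
  have hγ₀ := hγ.self_of_nhds.mdifferentiableAt (by simp)
  have hx := mem_extChartAt_source (I := 𝓘(ℝ, E)) (γ t₀)
  have hu := hasDerivAt_extChartAt_comp hγ₀ hx
  have hG := contDiffAt_chartMetric g (γ t₀) (mem_extChartAt_target (γ t₀))
  have hG' := (hG.differentiableAt (by simp)).hasFDerivAt.comp_hasDerivAt t₀ hu
  have hcov := covariantDeriv_mem_holonomyAlgebra hγ
    (hV.mono fun _ => mem_holonomyDistribution_iff.1)
    ((hasDerivAt_raisingOp hG' hV').congr_of_eventuallyEq
      ((hγ.self_of_nhds.continuousAt.eventually (extChartAt_source_mem_nhds (I := 𝓘(ℝ, E)) _)).mono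
        fun t ht => endCoord_raisingOp g ht (V t)))
  have hparallel := raisingOp_add_lie_middleOp (fun v w => fderiv_form_eq_christoffel_add
    (hG.differentiableAt (by simp)) (isInvertible_chartMetric g hx)
    (.of_forall (chartMetric_symm g (γ t₀))) (velocity γ t₀) v w) (V t₀)
  convert hcov using 1
  simp only [curveConnection_self hγ₀, connectionForm_eq, add_lie, comp_apply,
    tangentCoordChange_self hx, chartMetric_self] at hparallel ⊢
  rw [lie_raisingOp_raisingOp (form_symm g _), add_zero, ← lie_skew (loweringOp (g.form (γ t₀)) _),
    lie_raisingOp_loweringOp (form_symm g _), map_add, ← hparallel]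
  abel

theorem gradingOp_mem_holonomyAlgebra (hγ : ∀ᶠ t in 𝓝 t₀, ContMDiffAt 𝓘(ℝ, ℝ) 𝓘(ℝ, E) ∞ γ t)
    (hX : g.form (γ t₀) (velocity γ t₀) (velocity γ t₀) ≠ 0)
    (htop : ∀ᶠ t in 𝓝 t₀, holonomyDistribution g (γ t) = ⊤) :
    gradingOp E ∈ holonomyAlgebra g (γ t₀) := by
  let V (t : ℝ) : E := tangentCoordChange 𝓘(ℝ, E) (γ t₀) (γ t) (γ t) (velocity γ t₀)
  have hV₀ : V t₀ = velocity γ t₀ := tangentCoordChange_self (mem_extChartAt_source _)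
  have hV' : HasDerivAt (fun t => tangentCoordChange 𝓘(ℝ, E) (γ t) (γ t₀) (γ t) (V t)) 0 t₀ :=
    (hasDerivAt_const t₀ (velocity γ t₀)).congr_of_eventuallyEq
      ((hγ.self_of_nhds.continuousAt.eventually (extChartAt_source_mem_nhds (I := 𝓘(ℝ, E)) _)).mono
        fun t ht => tangentCoordChange_tangentCoordChange ht (mem_extChartAt_source _) _)
  have hcov := covariantDeriv_raisingOp_mem_holonomyAlgebra hγ (V := V)
    (htop.mono fun t ht => ht ▸ Submodule.mem_top) hV'
  rw [hV₀, rotation_self, map_zero, zero_sub, sub_neg_eq_add,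
    Submodule.add_mem_iff_right _ (raisingOp_mem_holonomyAlgebra htop.self_of_nhds _)] at hcov
  exact (Submodule.smul_mem_iff _ hX).1 hcov

theorem loweringOp_velocity_mem_holonomyAlgebra
    (hγ : ∀ᶠ t in 𝓝 t₀, ContMDiffAt 𝓘(ℝ, ℝ) 𝓘(ℝ, E) ∞ γ t)
    (htop : holonomyDistribution g (γ t₀) = ⊤)
    (hgrading : ∀ᶠ t in 𝓝 t₀, gradingOp E ∈ holonomyAlgebra g (γ t)) :
    loweringOp (g.form (γ t₀)) (velocity γ t₀) ∈ holonomyAlgebra g (γ t₀) := by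
  have hγ₀ := hγ.self_of_nhds.mdifferentiableAt (by simp)
  have hcov := covariantDeriv_mem_holonomyAlgebra (A' := 0) hγ hgrading (by
    simp only [endCoord_gradingOp]
    exact hasDerivAt_const t₀ (gradingOp E))
  rw [zero_add, ← lie_skew, curveConnection_self hγ₀, connectionForm_eq, chartMetric_self, lie_add,
    lie_add, lie_gradingOp_middleOp, lie_gradingOp_loweringOp, lie_gradingOp_raisingOp, zero_add,
    neg_add, neg_neg] at hcov
  exact (Submodule.add_mem_iff_left _
    (Submodule.neg_mem _ (raisingOp_mem_holonomyAlgebra htop _))).1 hcov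

theorem isGenericAt_of_gradingOp_mem (hγ : ∀ᶠ t in 𝓝 t₀, ContMDiffAt 𝓘(ℝ, ℝ) 𝓘(ℝ, E) ∞ γ t)
    (hX : g.form (γ t₀) (velocity γ t₀) (velocity γ t₀) ≠ 0)
    (htop : holonomyDistribution g (γ t₀) = ⊤)
    (hgrading : ∀ᶠ t in 𝓝 t₀, gradingOp E ∈ holonomyAlgebra g (γ t)) : IsGenericAt g (γ t₀) :=
  isGenericAt_iff.2 fun _ hA => hA.mem_lieSubalgebra (form_symm g _) (isInvertible_form g _)
    (L := lieSubalgebra (holonomyGroup g (γ t₀)))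
    (raisingOp_mem_holonomyAlgebra htop) hgrading.self_of_nhds hX
    (loweringOp_velocity_mem_holonomyAlgebra hγ htop hgrading)

theorem isGenericAt_of_curve (hγ : ∀ᶠ t in 𝓝 t₀, ContMDiffAt 𝓘(ℝ, ℝ) 𝓘(ℝ, E) ∞ γ t)
    (hX : ∀ᶠ t in 𝓝 t₀, g.form (γ t) (velocity γ t) (velocity γ t) ≠ 0)
    (htop : ∀ᶠ t in 𝓝 t₀, holonomyDistribution g (γ t) = ⊤) : IsGenericAt g (γ t₀) := by
  refine isGenericAt_of_gradingOp_mem hγ hX.self_of_nhds htop.self_of_nhds ?_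
  filter_upwards [hγ.eventually_nhds, hX, htop.eventually_nhds] with t hγt hXt htopt
  exact gradingOp_mem_holonomyAlgebra hγt hXt htopt

theorem isGenericAt_of_eventually_eq_top (hpq : 0 < p + q) {x : M}
    (htop : ∀ᶠ z in 𝓝 x, holonomyDistribution g z = ⊤) : IsGenericAt g x := by
  have hline {z : M} (X : E) {s : M → Prop} (hs : ∀ᶠ ζ in 𝓝 z, s ζ) :
      ∀ᶠ t in 𝓝 0, s (chartLine z X t) :=
    (eventually_contMDiffAt_chartLine_zero z X).self_of_nhds.continuousAt.eventually
      (by rwa [chartLine_zero])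
  have hX {z : M} {X : E} (h : g.form z X X ≠ 0) : g.form (chartLine z X 0)
      (velocity (chartLine z X) 0) (velocity (chartLine z X) 0) ≠ 0 := by
    rwa [velocity_chartLine_zero, chartLine_zero]
  have hgrading : ∀ᶠ z in 𝓝 x, gradingOp E ∈ holonomyAlgebra g z := by
    filter_upwards [htop.eventually_nhds] with z hz
    obtain ⟨Z, hZ⟩ := exists_form_self_ne_zero g z hpq
    simpa only [chartLine_zero] using gradingOp_mem_holonomyAlgebra
      (eventually_contMDiffAt_chartLine_zero z Z) (hX hZ) (hline Z hz)
  obtain ⟨X, hX₀⟩ := exists_form_self_ne_zero g x hpq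
  simpa only [chartLine_zero] using isGenericAt_of_gradingOp_mem
    (eventually_contMDiffAt_chartLine_zero x X) (hX hX₀)
    (by rw [chartLine_zero]; exact htop.self_of_nhds) (hline X hgrading)

end CovariantDerivative

/-! ### Sections of the holonomy distribution -/

theorem exists_apply_ne_zero_of_linearIndependent {ι K F : Type*} [Fintype ι] [Field K]
    [AddCommGroup F] [Module K F] {W : Submodule K F} [FiniteDimensional K W] {V : ι → F}
    (hV : LinearIndependent K V) (hVW : ∀ i, V i ∈ W) (hW : Module.finrank K W = Fintype.card ι)
    {f : F →ₗ[K] K} {v : F} (hv : v ∈ W) (hf : f v ≠ 0) : ∃ i, f (V i) ≠ 0 := by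
  by_contra! h
  have hspan : Submodule.span K (Set.range V) = W :=
    Submodule.eq_of_le_of_finrank_eq (Submodule.span_le.2 (Set.range_subset_iff.2 hVW))
      ((finrank_span_eq_card hV).trans hW.symm)
  have hker : Submodule.span K (Set.range V) ≤ LinearMap.ker f :=
    Submodule.span_le.2 (Set.range_subset_iff.2 h)
  exact hf (hker (hspan ▸ hv))

section Sections

variable {E : Type*} [NormedAddCommGroup E] [NormedSpace ℝ E]
  {M : Type*} [TopologicalSpace M] [ChartedSpace E M] [IsManifold 𝓘(ℝ, E) ∞ M] {x : M}

theorem differentiableAt_tangentCoordChange_chartLine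
    {V : ∀ x : M, TangentSpace 𝓘(ℝ, E) x} (hV : ContMDiffAt 𝓘(ℝ, E) 𝓘(ℝ, E).tangent ∞
      (fun x => (⟨x, V x⟩ : TangentBundle 𝓘(ℝ, E) M)) x) (X : E) :
    DifferentiableAt ℝ (fun t => tangentCoordChange 𝓘(ℝ, E) (chartLine x X t) x (chartLine x X t)
      (V (chartLine x X t))) 0 :=
  (ContMDiffAt.comp_of_eq ((Bundle.contMDiffAt_section x).1 hV)
    (eventually_contMDiffAt_chartLine_zero x X).self_of_nhds
    (chartLine_zero x X)).contDiffAt.differentiableAt (by simp)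

variable [FiniteDimensional ℝ E] {p q : ℕ} {g : SemiRiemannianMetric E M p q}

theorem holonomyDistribution_eq_top_of_lie_mem {V w : E} (hV : V ∈ holonomyDistribution g x)
    (hw : w ∈ holonomyDistribution g x) (hVw : g.form x V w ≠ 0)
    (hcov : ∀ X, ∃ Y, raisingOp (g.form x) Y - (middleOp (rotation (g.form x) X V) -
      g.form x X V • gradingOp E) ∈ holonomyAlgebra g x) : holonomyDistribution g x = ⊤ := by
  refine Submodule.eq_top_iff'.2 fun X => ?_
  obtain ⟨Y, hY⟩ := hcov X
  have hlie := lie_mem_lieAlgebra hY (mem_holonomyDistribution_iff.1 hw)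
  rw [sub_lie, sub_lie, smul_lie, lie_raisingOp_raisingOp (form_symm g x), zero_sub,
    lie_middleOp_raisingOp (isSkewFor_rotation (form_symm g x) X V), lie_gradingOp_raisingOp,
    ← map_smul, ← map_sub, ← map_neg, rotation_apply] at hlie
  have hX : g.form x V w • X = (g.form x X w • V + g.form x X V • w) -
      -(g.form x V w • X - g.form x X w • V - g.form x X V • w) := by abel
  refine (Submodule.smul_mem_iff _ hVw).1 (hX ▸ Submodule.sub_mem _ (Submodule.add_mem _
    (Submodule.smul_mem _ _ hV) (Submodule.smul_mem _ _ hw))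
    (mem_holonomyDistribution_iff.2 hlie))

theorem holonomyDistribution_eq_top_of_section {V : ∀ x : M, TangentSpace 𝓘(ℝ, E) x}
    (hV : ContMDiffAt 𝓘(ℝ, E) 𝓘(ℝ, E).tangent ∞
      (fun x => (⟨x, V x⟩ : TangentBundle 𝓘(ℝ, E) M)) x)
    (hmem : ∀ᶠ z in 𝓝 x, V z ∈ holonomyDistribution g z) {w : E}
    (hw : w ∈ holonomyDistribution g x) (hVw : g.form x (V x) w ≠ 0) :
    holonomyDistribution g x = ⊤ := by
  refine holonomyDistribution_eq_top_of_lie_mem hmem.self_of_nhds hw hVw fun X => ?_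
  have hγ := eventually_contMDiffAt_chartLine_zero x X
  have hmem' : ∀ᶠ t in 𝓝 0, V (chartLine x X t) ∈ holonomyDistribution g (chartLine x X t) :=
    hγ.self_of_nhds.continuousAt.eventually (by rwa [chartLine_zero])
  have hderiv := (differentiableAt_tangentCoordChange_chartLine hV X).hasDerivAt
  have hcov := covariantDeriv_raisingOp_mem_holonomyAlgebra hγ hmem'
    (by rw [chartLine_zero]; exact hderiv)
  rw [velocity_chartLine_zero, chartLine_zero] at hcov
  exact ⟨_, hcov⟩

/-- An adapted frame contains a field which pairs nontrivially with `𝓔`, so that `𝓔` has full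
rank at a point and hence on all of `U`. -/
theorem IsAdapted.isGenericAt {U : Set M} (hU : IsAdapted g U) (hpq : 0 < p + q) (hx : x ∈ U)
    {v w : E} (hv : v ∈ holonomyDistribution g x) (hw : w ∈ holonomyDistribution g x)
    (hvw : g.form x v w ≠ 0) : IsGenericAt g x := by
  obtain ⟨hUopen, k, hk, V, hV, hVmem⟩ := hU
  obtain ⟨i, hi⟩ : ∃ i, g.form x (V i x) w ≠ 0 :=
    exists_apply_ne_zero_of_linearIndependent (F := E) (V := fun i => V i x)
      (W := holonomyDistribution g x) (f := ((g.form x).flip w : E →ₗ[ℝ] ℝ))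
      (hVmem x hx).1 (hVmem x hx).2 ((hk x hx).trans (Fintype.card_fin k).symm) hv hvw
  have htop : holonomyDistribution g x = ⊤ := holonomyDistribution_eq_top_of_section
    ((hV i).contMDiffAt (hUopen.mem_nhds hx))
    ((hUopen.eventually_mem hx).mono fun z hz => (hVmem z hz).2 i) hw hi
  refine isGenericAt_of_eventually_eq_top hpq ((hUopen.eventually_mem hx).mono fun z hz => ?_)
  rw [← holonomyRank_eq_iff, hk z hz, ← hk x hx, holonomyRank_eq_iff, htop]

theorem IsGenericAt.forall [PreconnectedSpace M] (hx : IsGenericAt g x) (y : M) :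
    IsGenericAt g y := by
  obtain ⟨P, hP⟩ := exists_isTransport g x y
  exact hx.of_isTransport hP

end Sections

theorem mainTheorem7_general {E : Type*} [NormedAddCommGroup E] [NormedSpace ℝ E]
    [FiniteDimensional ℝ E] {M : Type*} [TopologicalSpace M] [ChartedSpace E M]
    [IsManifold 𝓘(ℝ, E) ∞ M] [PreconnectedSpace M] (p q : ℕ) (hn : 3 ≤ p + q)
    (g : SemiRiemannianMetric E M p q) :
    (∀ (a b : ℝ) (γ : ℝ → M), a < b →
      ContMDiffOn 𝓘(ℝ, ℝ) 𝓘(ℝ, E) ∞ γ (Set.Ioo a b) →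
      (∀ t ∈ Set.Ioo a b, g.form (γ t) (velocity γ t) (velocity γ t) ≠ 0) →
      (∀ t ∈ Set.Ioo a b, holonomyRank g (γ t) = p + q) →
      (∀ x, IsGenericAt g x) ∧ ∀ x, holonomyRank g x = p + q) ∧
    ∀ U : Set M, IsAdapted g U →
      (∀ x ∈ U, ∀ v ∈ holonomyDistribution g x, ∀ w ∈ holonomyDistribution g x,
        g.form x v w = 0) ∨
      ∀ x, IsGenericAt g x := by
  refine ⟨fun a b γ hab hγ hX hrank => ?_, fun U hU => or_iff_not_imp_left.2 fun hnull => ?_⟩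
  · obtain ⟨t, ht⟩ := Set.nonempty_Ioo.2 hab
    have hIoo := isOpen_Ioo.eventually_mem ht
    have hgeneric : IsGenericAt g (γ t) := isGenericAt_of_curve
      (hIoo.mono fun s hs => hγ.contMDiffAt (isOpen_Ioo.mem_nhds hs)) (hIoo.mono hX)
      (hIoo.mono fun s hs => holonomyRank_eq_iff.1 (hrank s hs))
    exact ⟨hgeneric.forall, fun x =>
      holonomyRank_eq_iff.2 (hgeneric.forall x).holonomyDistribution_eq_top⟩
  · push Not at hnull
    obtain ⟨x, hx, v, hv, w, hw, hvw⟩ := hnull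
    exact (hU.isGenericAt (by omega) hx hv hw hvw).forall

end ConformalHolonomy

end

open ConformalHolonomy in
theorem mainTheorem7 {E : Type*} [NormedAddCommGroup E] [NormedSpace ℝ E] [FiniteDimensional ℝ E]
    {M : Type*} [TopologicalSpace M] [ChartedSpace E M] [IsManifold 𝓘(ℝ, E) ∞ M]
    [T2Space M] [SecondCountableTopology M] [ConnectedSpace M]
    (p q : ℕ) (hn : 3 ≤ p + q) (c : ConformalStructure E M p q)
    (g : SemiRiemannianMetric E M p q) (hg : g ∈ c) :
    (∀ (a b : ℝ) (γ : ℝ → M), a < b →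
      ContMDiffOn 𝓘(ℝ, ℝ) 𝓘(ℝ, E) ∞ γ (Set.Ioo a b) →
      (∀ t ∈ Set.Ioo a b, g.form (γ t) (velocity γ t) (velocity γ t) ≠ 0) →
      (∀ t ∈ Set.Ioo a b, holonomyRank g (γ t) = p + q) →
      (∀ x, IsGenericAt g x) ∧ ∀ x, holonomyRank g x = p + q) ∧
    ∀ U : Set M, IsAdapted g U →
      (∀ x ∈ U, ∀ v ∈ holonomyDistribution g x, ∀ w ∈ holonomyDistribution g x,
        g.form x v w = 0) ∨
      ∀ x, IsGenericAt g x :=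
  mainTheorem7_general p q hn g
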